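/- Let $W:\mathbb{R}\to\mathbb{C}$ be a weight function (not necessarily nonnegative) such that $\int_{\mathbb{R}} e^{ax}|W(x)|\,dx<\infty$ for every real $a$ and such that the measure $W(x)\,dx$ has infinite support (equivalently, $W$ is not almost everywhere $0$). Let $M_j:=\int_{\mathbb{R}} x^jW(x)\,dx$, $j\ge 0$, be its moments. Let $\mathbf{t}=(t_1,t_2,\dots)$ be a sequence of variables and define the elementary Schur polynomials $h_j(\mathbf{t})$, $j\in\mathbb{Z}$, by $\sum_{j\in\mathbb{Z}}h_j(\mathbf{t})w^j=\exp\big(\sum_{j\ge1}t_jw^j\big)$. Let $C_d\neq0$ ($d\ge 1$) be constants and put $\hat C_d:=1/(d!\,C_d)$. (In the Hermitian matrix model with external source, $C_d$ is the constant in the reduction of the partition function to an integral over eigenvalues.) Define the formal power series $$\hat Z_d(\mathbf{t}):=\frac{1}{d!\,\hat C_d}\sum_{j_1,\dots,j_d=0}^{\infty}\frac{\det\big[M_{j_p+q-1}\big]_{p,q=1}^{d}\,\det\big[h_{j_p-d+q}(\mathbf{t})\big]_{p,q=1}^{d}}{\prod_{k=1}^{d}j_k!}\quad(d\ge1),\qquad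 \hat Z_0(\mathbf{t}):=1.$$ Then the two-sided sequence $$(\tau_n)_{n\in\mathbb{Z}}=(\dots,\hat Z_2(-\mathbf{t}),\hat Z_1(-\mathbf{t}),\hat Z_0(\mathbf{t}),\hat Z_1(\mathbf{t}),\hat Z_2(\mathbf{t}),\dots),\qquad \tau_0=\hat Z_0,$$ is a discrete KP $\tau$ vector. This means the following. All $\tau_n$ are nonzero formal power series, and, with $\Lambda=(\delta_{i,j-1})_{i,j\in\mathbb{Z}}$ the shift matrix, there is a matrix $L=\Lambda+\sum_{j\le0}a_j(\mathbf{t})\Lambda^j$ (the $a_j$ diagonal matrices with entries in the field of fractions of $\mathbb{C}[[t_1,t_2,\dots]]$) that satisfies the discrete KP hierarchy $$\frac{\partial L}{\partial t_k}=\big[(L^k)_+,L\big],\qquad k=1,2,\dots,$$ where $A_+$ is the upper triangular part of $A$ including the diagonal, and whose wave vector is given by $\tau$: the vector $\Psi=(\Psi_n)_{n\in\mathbb{Z}}$ with $$\Psi_n(\mathbf{t},z)=\frac{\tau_n(\mathbf{t}-[z^{-1}])}{\tau_n(\mathbf{t})}\,e^{\sum_{j\ge1}t_jz^j}\,z^n,\qquad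 [c]:=\Big(c,\frac{c^2}{2},\frac{c^3}{3},\dots\Big),$$ satisfies $L\Psi=z\Psi$ and $\partial\Psi/\partial t_k=(L^k)_+\Psi$ for all $k\ge1$. -/

import Mathlib

open MeasureTheory
open scoped Nat

noncomputable section

namespace DiscreteKP

/-- Formal power series over `ℂ` in the variables `t = (t₁, t₂, …)`; `MvPowerSeries.X k` is `t_k`. -/
abbrev TimeSeries : Type := MvPowerSeries ℕ+ ℂ

/-- The field of fractions of the ring of formal power series in `t`. -/
abbrev TimeField : Type := FractionRing TimeSeries

/-! ### Elementary Schur polynomials -/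

/-- The series `∑_{j ≥ 1} t_j w^j` in the variable `w`. -/
def timeSum : PowerSeries TimeSeries :=
  PowerSeries.mk fun j => if hj : 0 < j then MvPowerSeries.X (Nat.toPNat j hj) else 0

/-- The elementary Schur polynomials `h_j(t)`, `j ∈ ℤ`, given by
`∑_{j ∈ ℤ} h_j(t) w^j = exp (∑_{j ≥ 1} t_j w^j)`; in particular `h_j = 0` for `j < 0`. -/
def schurPoly (j : ℤ) : TimeSeries :=
  if j < 0 then 0
  else PowerSeries.coeff j.toNat ((PowerSeries.exp ℂ).subst timeSum)

/-! ### The formal power series `Ẑ_d(t)` -/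

/-- The moments `M_j = ∫ x^j W(x) dx`. -/
def moment (W : ℝ → ℂ) (j : ℕ) : ℂ := ∫ x : ℝ, (x : ℂ) ^ j * W x

/-- `Ĉ_d = 1 / (d! C_d)`. -/
def CHat (C : ℕ → ℂ) (d : ℕ) : ℂ := 1 / ((d ! : ℂ) * C d)

/-- The summand
`det [M_{j_p+q-1}]_{p,q=1}^d * det [h_{j_p-d+q}(t)]_{p,q=1}^d / ∏_k j_k!`
(`p` and `q` are counted from `0` in the code). -/
def ZHatTerm (M : ℕ → ℂ) (d : ℕ) (j : Fin d → ℕ) : TimeSeries :=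
  ((Matrix.of fun p q : Fin d => M (j p + (q : ℕ))).det / (∏ k, ((j k)! : ℂ))) •
    (Matrix.of fun p q : Fin d => schurPoly ((j p : ℤ) - (d : ℤ) + ((q : ℕ) + 1 : ℤ))).det

/-- The formal power series `Ẑ_d(t)`: for `d ≥ 1` it is
`(1 / (d! Ĉ_d)) ∑_{j_1, …, j_d ≥ 0} (summand)`, and `Ẑ_0 = 1`. The sum of power series is taken
coefficient by coefficient; only finitely many summands contribute to a given coefficient
(`finite_support_coeff_ZHatTerm` below). -/
def ZHat (C M : ℕ → ℂ) (d : ℕ) : TimeSeries :=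
  if d = 0 then 1
  else (1 / ((d ! : ℂ) * CHat C d)) •
    (fun m : ℕ+ →₀ ℕ => ∑ᶠ j : Fin d → ℕ, MvPowerSeries.coeff m (ZHatTerm M d j) : TimeSeries)

/-- `f(-t)`. -/
def negTimes (f : TimeSeries) : TimeSeries := MvPowerSeries.rescale (fun _ => (-1 : ℂ)) f

/-- The two-sided sequence `(…, Ẑ_2(-t), Ẑ_1(-t), Ẑ_0(t), Ẑ_1(t), Ẑ_2(t), …)`, with `Ẑ_0(t)`
at position `0`. -/
def ZHatSequence (C M : ℕ → ℂ) : ℤ → TimeSeries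
  | Int.ofNat d => ZHat C M d
  | Int.negSucc d => negTimes (ZHat C M (d + 1))

/-! ### The discrete KP hierarchy

Operators on two-sided sequences are `ℤ × ℤ` matrices with entries in the field `TimeField`.
All products below are of matrices for which each entry of the product is a finite sum. -/

/-- `ℤ × ℤ` matrices of functions of `t`. -/
abbrev BiMatrix : Type := ℤ → ℤ → TimeField

/-- The matrix product. -/
def biMul (A B : BiMatrix) : BiMatrix := fun n l => ∑ᶠ m : ℤ, A n m * B m l

/-- The powers of a matrix. -/
def biPow (A : BiMatrix) : ℕ → BiMatrix
  | 0 => fun n m => if n = m then 1 else 0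
  | k + 1 => biMul A (biPow A k)

/-- The shift matrix `Λ = (δ_{n, m-1})`, so that `(Λ v)_n = v_{n+1}`. -/
def shiftMatrix : BiMatrix := fun n m => if m = n + 1 then 1 else 0

/-- The upper triangular part `A_+` of `A`, including the diagonal. -/
def upperPart (A : BiMatrix) : BiMatrix := fun n m => if n ≤ m then A n m else 0

/-- The partial derivative `∂/∂t_k` on the field of fractions, by the quotient rule
(it does not depend on the chosen fraction, see `timeDeriv_div` below). -/
def timeDeriv (k : ℕ+) (x : TimeField) : TimeField :=
  let a : TimeSeries := (IsLocalization.sec (nonZeroDivisors TimeSeries) x).1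
  let b : TimeSeries := (IsLocalization.sec (nonZeroDivisors TimeSeries) x).2
  algebraMap TimeSeries TimeField
      (MvPowerSeries.pderiv ℂ k a * b - a * MvPowerSeries.pderiv ℂ k b) /
    algebraMap TimeSeries TimeField b ^ 2

/-- The series `f(t - [u])`, where `[u] = (u, u²/2, u³/3, …)`, as a formal power series in the
variables `t_k` (index `some k`) and `u` (index `none`). -/
def miwaShift (f : TimeSeries) : MvPowerSeries (Option ℕ+) ℂ :=
  MvPowerSeries.subst
    (fun k : ℕ+ => (MvPowerSeries.X (some k) -
      (1 / ((k : ℕ) : ℂ)) • MvPowerSeries.X none ^ (k : ℕ) : MvPowerSeries (Option ℕ+) ℂ)) f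

/-- The coefficient of `z^{-i}` in `f(t - [z⁻¹])`, a formal power series in `t`. -/
def miwaCoeff (f : TimeSeries) (i : ℕ) : TimeSeries :=
  fun m => MvPowerSeries.coeff (m.optionElim i) (miwaShift f)

/-- The wave matrix `S` of a sequence `τ`: a lower triangular matrix with unit diagonal for which
`∑_m S_{n,m} z^m = (τ_n(t - [z⁻¹]) / τ_n(t)) z^n`. -/
def waveMatrix (τ : ℤ → TimeSeries) : BiMatrix := fun n m =>
  if m ≤ n then
    algebraMap TimeSeries TimeField (miwaCoeff (τ n) (n - m).toNat) /
      algebraMap TimeSeries TimeField (τ n)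
  else 0

/-- `L = Λ + ∑_{j ≤ 0} a_j Λ^j` with diagonal matrices `a_j`, and `L` satisfies the equations of
the discrete KP hierarchy, `∂L/∂t_k = [(L^k)_+, L]` for all `k ≥ 1`. -/
structure IsDiscreteKPSolution (L : BiMatrix) : Prop where
  superdiagonal : ∀ n : ℤ, L n (n + 1) = 1
  above : ∀ n m : ℤ, n + 1 < m → L n m = 0
  lax : ∀ (k : ℕ+) (n m : ℤ), timeDeriv k (L n m) =
    biMul (upperPart (biPow L k)) L n m - biMul L (upperPart (biPow L k)) n m

/-- The sequence `τ = (τ_n(t))_{n ∈ ℤ}` of non-zero formal power series is a discrete KP `τ` vector: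
there is a solution `L` of the discrete KP hierarchy whose wave vector is
`Ψ_n(t, z) = (τ_n(t - [z⁻¹]) / τ_n(t)) e^{∑_{j ≥ 1} t_j z^j} z^n`, that is,
`L Ψ = z Ψ` and `∂Ψ/∂t_k = (L^k)_+ Ψ` for all `k ≥ 1`.
In terms of `Ψ = S e^{∑ t_j z^j} (z^n)_n`, where `S` is the wave matrix and `z (z^n)_n = Λ (z^n)_n`,
these equations read `L S = S Λ` and `∂S/∂t_k + S Λ^k = (L^k)_+ S`. -/
structure IsDiscreteKPTauVector (τ : ℤ → TimeSeries) : Prop where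
  ne_zero : ∀ n : ℤ, τ n ≠ 0
  exists_solution : ∃ L : BiMatrix, IsDiscreteKPSolution L ∧
    biMul L (waveMatrix τ) = biMul (waveMatrix τ) shiftMatrix ∧
    ∀ (k : ℕ+) (n m : ℤ),
      timeDeriv k (waveMatrix τ n m) + biMul (waveMatrix τ) (biPow shiftMatrix k) n m =
        biMul (upperPart (biPow L k)) (waveMatrix τ) n m

/-! ### Facts that justify the definitions -/

theorem timeDeriv_div (k : ℕ+) (a b : TimeSeries) (hb : b ≠ 0) :
    timeDeriv k (algebraMap TimeSeries TimeField a / algebraMap TimeSeries TimeField b) =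
      algebraMap TimeSeries TimeField
          (MvPowerSeries.pderiv ℂ k a * b - a * MvPowerSeries.pderiv ℂ k b) /
        algebraMap TimeSeries TimeField b ^ 2 := by
  have inj : Function.Injective (algebraMap TimeSeries TimeField) :=
    IsFractionRing.injective TimeSeries TimeField
  have hb' : algebraMap TimeSeries TimeField b ≠ 0 := fun h => hb (inj (by rw [h, map_zero]))
  have h := IsLocalization.sec_spec (nonZeroDivisors TimeSeries)
    (algebraMap TimeSeries TimeField a / algebraMap TimeSeries TimeField b)
  unfold timeDeriv
  set s := IsLocalization.sec (nonZeroDivisors TimeSeries)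
    (algebraMap TimeSeries TimeField a / algebraMap TimeSeries TimeField b) with hs
  have hd : (s.2 : TimeSeries) ≠ 0 := nonZeroDivisors.ne_zero s.2.2
  have hd' : algebraMap TimeSeries TimeField (s.2 : TimeSeries) ≠ 0 :=
    fun h => hd (inj (by rw [h, map_zero]))
  rw [div_mul_eq_mul_div, div_eq_iff hb', ← map_mul, ← map_mul] at h
  have h0 : a * (s.2 : TimeSeries) = s.1 * b := inj h
  have h1 := congrArg (MvPowerSeries.pderiv ℂ k) h0
  rw [Derivation.leibniz, Derivation.leibniz] at h1
  simp only [smul_eq_mul] at h1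
  rw [div_eq_div_iff (pow_ne_zero 2 hd') (pow_ne_zero 2 hb'), ← map_pow, ← map_pow,
    ← map_mul, ← map_mul]
  congr 1
  linear_combination (-(b * (s.2 : TimeSeries))) * h1 +
    (b * MvPowerSeries.pderiv ℂ k (s.2 : TimeSeries) +
      (s.2 : TimeSeries) * MvPowerSeries.pderiv ℂ k b) * h0

/-- The weight of a monomial in `t`, with `t_k` of weight `k`. -/
def timeWeight (m : ℕ+ →₀ ℕ) : ℕ := Finsupp.weight (fun k : ℕ+ => (k : ℕ)) m

theorem hasSubst_timeSum : PowerSeries.HasSubst timeSum :=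
  PowerSeries.HasSubst.of_constantCoeff_zero' (by
    rw [← PowerSeries.coeff_zero_eq_constantCoeff_apply]; simp [timeSum])

theorem hasSubst_miwa : MvPowerSeries.HasSubst (fun k : ℕ+ => (MvPowerSeries.X (some k) -
    (1 / ((k : ℕ) : ℂ)) • MvPowerSeries.X none ^ (k : ℕ) : MvPowerSeries (Option ℕ+) ℂ)) := by
  classical
  constructor
  · intro k
    have hk : (k : ℕ) ≠ 0 := k.ne_zero
    simp [hk, MvPowerSeries.smul_eq_C_mul]
  · intro d
    refine Set.Finite.subset
      ((Set.finite_Iic (d none)).preimage (PNat.coe_injective.injOn) |>.union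
        ((d.support.finite_toSet).preimage (Option.some_injective _).injOn)) ?_
    intro k hk
    by_contra hcon
    apply hk
    simp only [Set.mem_union, Set.mem_preimage, Set.mem_Iic, SetLike.mem_coe,
      Finsupp.mem_support_iff, not_or, not_le, not_not] at hcon
    have h1 : d ≠ Finsupp.single (some k) 1 := by
      intro h
      have := hcon.2
      rw [h] at this
      simp at this
    have h2 : d ≠ Finsupp.single none (k : ℕ) := by
      intro h
      have := hcon.1
      rw [h] at this
      simp at this
    simp [MvPowerSeries.coeff_X, MvPowerSeries.coeff_X_pow, h1, h2]

theorem coeff_timeSum_pow (n j : ℕ) (m : ℕ+ →₀ ℕ) (h : timeWeight m < j) :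
    MvPowerSeries.coeff m (PowerSeries.coeff j (timeSum ^ n)) = 0 := by
  classical
  induction n generalizing j m with
  | zero =>
    rw [pow_zero, PowerSeries.coeff_one, if_neg (by omega), map_zero]
  | succ n ih =>
    rw [pow_succ, PowerSeries.coeff_mul, map_sum]
    refine Finset.sum_eq_zero fun x hx => ?_
    rw [MvPowerSeries.coeff_mul]
    refine Finset.sum_eq_zero fun y hy => ?_
    rw [Finset.HasAntidiagonal.mem_antidiagonal] at hx hy
    have hw : timeWeight y.1 + timeWeight y.2 = timeWeight m := by
      rw [← hy]; simp [timeWeight]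
    by_cases h1 : timeWeight y.1 < x.1
    · rw [ih _ _ h1, zero_mul]
    · have h2 : timeWeight y.2 < x.2 := by omega
      have : MvPowerSeries.coeff y.2 (PowerSeries.coeff x.2 timeSum) = 0 := by
        have hx2 : 0 < x.2 := by omega
        rw [timeSum, PowerSeries.coeff_mk, dif_pos hx2, MvPowerSeries.coeff_X, if_neg]
        intro hy2
        rw [hy2] at h2
        simp only [timeWeight, Finsupp.weight_single, one_smul] at h2
        exact absurd h2 (lt_irrefl _)
      rw [this, mul_zero]

theorem coeff_schurPoly (j : ℤ) (m : ℕ+ →₀ ℕ) (h : (timeWeight m : ℤ) < j) :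
    MvPowerSeries.coeff m (schurPoly j) = 0 := by
  have hj : ¬ j < 0 := by omega
  rw [schurPoly, if_neg hj, PowerSeries.coeff_subst' hasSubst_timeSum,
    finsum_eq_sum _ (PowerSeries.coeff_subst_finite' hasSubst_timeSum _ _), map_sum]
  refine Finset.sum_eq_zero fun n _ => ?_
  rw [MvPowerSeries.coeff_smul, coeff_timeSum_pow _ _ _ (by omega), mul_zero]

theorem finite_support_coeff_ZHatTerm (M : ℕ → ℂ) (d : ℕ) (m : ℕ+ →₀ ℕ) :
    (Function.support fun j : Fin d → ℕ => MvPowerSeries.coeff m (ZHatTerm M d j)).Finite := by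
  classical
  refine (Set.finite_Iic (fun _ : Fin d => timeWeight m + d)).subset ?_
  intro j hj
  rw [Set.mem_Iic]
  by_contra hcon
  apply hj
  obtain ⟨p, hp⟩ : ∃ p, timeWeight m + d < j p := by
    simpa [Pi.le_def] using hcon
  change MvPowerSeries.coeff m (ZHatTerm M d j) = 0
  rw [ZHatTerm, MvPowerSeries.coeff_smul]
  refine mul_eq_zero_of_right _ ?_
  rw [← Matrix.det_transpose, Matrix.det_apply, map_sum, Finset.sum_eq_zero]
  intro σ _
  rw [← Finset.mul_prod_erase _ _ (Finset.mem_univ p), Units.smul_def, map_zsmul,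
    MvPowerSeries.coeff_mul, Finset.sum_eq_zero, smul_zero]
  intro y hy
  rw [Finset.HasAntidiagonal.mem_antidiagonal] at hy
  have hw : timeWeight y.1 + timeWeight y.2 = timeWeight m := by
    rw [← hy]; simp [timeWeight]
  simp only [Matrix.transpose_apply, Matrix.of_apply]
  rw [coeff_schurPoly _ _ (by omega), zero_mul]

end DiscreteKP

end

/-! Put `f_a^{(b)} = ∑_j M_{j+a} h_{j-b}(t) / j!`. The generating function of the `h_j` is an
exponential, so `∂f_a^{(b)}/∂t_k = f_a^{(b+k)}`, and Cauchy–Binet turns `Ẑ_d` into a nonzero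
constant times the Wronskian `det [f_a^{(d-1-q)}]`, with `a, q < d` (`finsum_coeff_ZHatTerm`,
`exists_ZHat_eq`).

Nonvanishing (`wronskianDet_ne_zero`): on the `t_1` axis this is an ordinary Wronskian. If it
vanished, some nontrivial constant combination of the `f_a` would vanish. At `t = 0` its derivatives
give `∑_a γ_a M_{j+a} = 0` for all `j`, so `p(x) W(x)`, with `p = ∑ γ_a x^a`, has no nonzero moment.
Exponential integrability then makes its Fourier transform zero, and `W = 0` almost everywhere.

The hierarchy (`isDiscreteKPSolution_of_dressing`): let `S` be the wave matrix, `T = S⁻¹` and `L = S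
Λ T`. All equations follow once `(∂S/∂t_k + S Λ^k) T` is upper triangular. Rows of nonnegative and
negative index satisfy this for dual reasons, both read off from the Miwa shift.

For `n ≥ 0` the shift is `f_a^{(b)}(t - [u]) = f_a^{(b)} - u f_a^{(b+1)}`. Hence row `n` of `S`
consists of normalized signed minors, vanishes in negative columns, and is orthogonal to the vectors
`(f_a^{(m)})_{m ≥ 0}` with `a < n`. These conditions survive `S ↦ ∂S/∂t_k + S Λ^k`, and
orthogonality to `n` such vectors forces the entries of row `n` of the product left of the diagonal
to vanish (`dressing_upper_nonneg`).

For `n = -1 - c`, put `g_a^{(b)}(t) = f_a^{(b)}(-t)`. Then `g_a^{(b)}(t - [u]) = ∑_i u^i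
g_a^{(b+i)}(t)`, and in negative columns row `n` of `S` is a combination of the vectors
`(g_a^{(-1-m)})_{m < 0}` with `a ≤ c`. Here it is a span that is preserved, and the columns of `T`
far enough to the left are orthogonal to it (`dressing_upper_neg`). -/

noncomputable section

namespace DiscreteKP

/-! ### Determinants with an auxiliary variable; Cauchy–Binet. -/

section Determinants

variable {R : Type*} [CommRing R]

/-- The determinant of the matrix with first row `y` and further rows `F`. -/
theorem det_cons_row (d : ℕ) (y : Fin (d + 1) → R) (F : Fin d → Fin (d + 1) → R) :
    (Matrix.of (Fin.cons y F : Fin (d + 1) → Fin (d + 1) → R)).det =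
      ∑ i : Fin (d + 1), (-1) ^ (i : ℕ) * y i *
          (Matrix.of fun a q : Fin d => F a (i.succAbove q)).det := by
  rw [Matrix.det_succ_row_zero]
  rfl

/-- Border the matrix by the row `(1, 0, …, 0)` and the column of the `F a d`. Adding `X` times the
preceding column, from left to right, turns the first row into `(1, X, X², …)` and removes `X` from
all other rows; expanding along the first row gives the minors. -/
theorem det_C_sub_X_mul (d : ℕ) (F : Fin d → ℕ → R) :
    (Matrix.of fun a q : Fin d => (PowerSeries.C (F a (d - 1 - q)) -
        PowerSeries.X * PowerSeries.C (F a (d - 1 - q + 1)) : PowerSeries R)).det =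
      ∑ i : Fin (d + 1), PowerSeries.X ^ (i : ℕ) * PowerSeries.C ((-1) ^ (i : ℕ) *
        (Matrix.of fun a q : Fin d => F a (d - (i.succAbove q : ℕ))).det) := by
  have h1 := det_cons_row d (fun i => (PowerSeries.X : PowerSeries R) ^ (i : ℕ))
    (fun a i => PowerSeries.C (F a (d - i)))
  have h2 := det_cons_row d (fun i => if i = 0 then (1 : PowerSeries R) else 0)
    (fun a => Fin.cons (PowerSeries.C (F a d)) (fun q : Fin d => PowerSeries.C (F a (d - 1 - q)) -
        PowerSeries.X * PowerSeries.C (F a (d - 1 - q + 1))))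
  rw [Finset.sum_eq_single 0 (by intro b _ hb; simp [hb]) (by simp)] at h2
  simp only [Fin.val_zero, pow_zero, if_true, one_mul, Fin.succAbove_zero, Fin.cons_succ] at h2
  rw [← h2, ← Matrix.det_eq_of_forall_col_eq_smul_add_pred (fun _ => PowerSeries.X) _ _, h1]
  · refine Finset.sum_congr rfl fun i _ => ?_
    rw [map_mul, map_pow, map_neg, map_one, RingHom.map_det]
    have : (PowerSeries.C (R := R)).mapMatrix
        (Matrix.of fun a q : Fin d => F a (d - (i.succAbove q : ℕ))) =
        Matrix.of fun a q : Fin d => PowerSeries.C (F a (d - (i.succAbove q : ℕ))) := by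
      ext; rfl
    rw [this]
    ring
  · intro i
    refine Fin.cases ?_ (fun a => ?_) i <;> simp
  · intro i q
    refine Fin.cases ?_ (fun a => ?_) i
    · simp [pow_succ']
    · have : d - 1 - (q : ℕ) + 1 = d - q := by omega
      have h' : d - ((q : ℕ) + 1) = d - 1 - q := by omega
      simp [this, h']

theorem coeff_det_C_sub_X_mul_of_lt (d : ℕ) (F : Fin d → ℕ → R) {i : ℕ} (hi : d < i) :
    PowerSeries.coeff i (Matrix.of fun a q : Fin d => (PowerSeries.C (F a (d - 1 - q)) -
        PowerSeries.X * PowerSeries.C (F a (d - 1 - q + 1)) : PowerSeries R)).det = 0 := by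
  rw [det_C_sub_X_mul, map_sum]
  refine Finset.sum_eq_zero fun j _ => ?_
  have : i ≠ j := by omega
  rw [PowerSeries.coeff_mul_C, PowerSeries.coeff_X_pow, if_neg this, zero_mul]

/-- The coefficients are the cofactors of a first row, so pairing them with row `a` gives a
determinant with a repeated row. -/
theorem sum_coeff_det_C_sub_X_mul (d : ℕ) (F : Fin d → ℕ → R) (a : Fin d) :
    ∑ i ∈ Finset.range (d + 1), PowerSeries.coeff i
      (Matrix.of fun a q : Fin d => (PowerSeries.C (F a (d - 1 - q)) -
        PowerSeries.X * PowerSeries.C (F a (d - 1 - q + 1)) : PowerSeries R)).det * F a (d - i) =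
      0 := by
  have h := det_cons_row d (fun i => F a (d - i)) (fun a i => F a (d - i))
  rw [Matrix.det_zero_of_row_eq (i := 0) (j := a.succ) (Fin.succ_ne_zero a).symm (by ext; simp)]
    at h
  rw [h, Finset.sum_range]
  refine Finset.sum_congr rfl fun i _ => ?_
  rw [det_C_sub_X_mul, map_sum, Finset.sum_eq_single i]
  · simp only [PowerSeries.coeff_mul_C, PowerSeries.coeff_X_pow, if_true]
    ring
  · intro j _ hj
    have : (i : ℕ) ≠ j := fun h => hj (Fin.ext h.symm)
    rw [PowerSeries.coeff_mul_C, PowerSeries.coeff_X_pow, if_neg this, zero_mul]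
  · simp

theorem det_cons_col (e : ℕ) (y : Fin (e + 1) → R) (F : Fin (e + 1) → Fin e → R) :
    (Matrix.of fun a => (Fin.cons (y a) (F a) : Fin (e + 1) → R)).det =
      ∑ a, y a * ((-1) ^ (a : ℕ) * (Matrix.of fun p q : Fin e => F (a.succAbove p) q).det) := by
  rw [Matrix.det_succ_column_zero]
  refine Finset.sum_congr rfl fun a _ => ?_
  have : (Matrix.of fun a => (Fin.cons (y a) (F a) : Fin (e + 1) → R)).submatrix a.succAbove
      Fin.succ = Matrix.of fun p q : Fin e => F (a.succAbove p) q := by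
    ext p q; simp
  rw [this]
  simp only [Matrix.of_apply, Fin.cons_zero]
  ring

/-- The recursion means `G a b = ∑_i X^i g a (b + i)`. Subtracting `X` times the preceding column
makes every column but the first constant, and `w` is the vector of cofactors of that first column.
Its vanishing pairings come from repeated columns. -/
theorem exists_coeff_det_of_eq_C_add_X_mul (e : ℕ) (g : Fin (e + 1) → ℕ → R)
    (G : Fin (e + 1) → ℕ → PowerSeries R)
    (hG : ∀ a b, G a b = PowerSeries.C (g a b) + PowerSeries.X * G a (b + 1)) :
    ∃ w : Fin (e + 1) → R,
      (∀ i, PowerSeries.coeff i (Matrix.of fun a q : Fin (e + 1) => G a (e - q)).det =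
        ∑ a, g a (e + i) * w a) ∧ ∀ b < e, ∑ a, g a b * w a = 0 := by
  have hcoeff : ∀ i a b, PowerSeries.coeff i (G a b) = g a (b + i) := by
    intro i
    induction i with
    | zero => intro a b; rw [hG]; simp
    | succ i ih =>
      intro a b
      rw [hG, map_add, PowerSeries.coeff_succ_X_mul, ih, PowerSeries.coeff_C]
      simp [add_assoc, add_comm 1 i]
  refine ⟨fun a => (-1) ^ (a : ℕ) *
    (Matrix.of fun p q : Fin e => g (a.succAbove p) (e - 1 - q)).det, fun i => ?_, fun b hb => ?_⟩
  · rw [Matrix.det_eq_of_forall_col_eq_smul_add_pred (fun _ => PowerSeries.X)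
      (B := Matrix.of fun a => (Fin.cons (G a e) (fun q : Fin e =>
        PowerSeries.C (g a (e - 1 - q))) : Fin (e + 1) → PowerSeries R)) (by simp), det_cons_col,
      map_sum]
    · refine Finset.sum_congr rfl fun a _ => ?_
      rw [← hcoeff, ← PowerSeries.coeff_mul_C]
      simp only [map_mul, map_pow, map_neg, map_one, RingHom.map_det]
      rfl
    · intro a q
      have : e - ((q : ℕ) + 1) = e - 1 - q := by omega
      have h' : e - 1 - (q : ℕ) + 1 = e - q := by omega
      simp only [Matrix.of_apply, Fin.cons_succ, Fin.val_succ, Fin.val_castSucc]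
      rw [hG, this, h']
  · rw [← det_cons_col e (fun a => g a b) (fun a q => g a (e - 1 - q))]
    refine Matrix.det_zero_of_column_eq (i := 0) (j := Fin.succ ⟨e - 1 - b, by omega⟩)
      (Fin.succ_ne_zero _).symm fun a => ?_
    have : e - 1 - (e - 1 - b) = b := by omega
    simp only [Matrix.of_apply, Fin.cons_zero, Fin.cons_succ, this]

/-- Cauchy–Binet, summed over all index functions. -/
theorem sum_det_mul_det {d : ℕ} {ι : Type*} [Fintype ι] [DecidableEq ι] (A B : ι → Fin d → R) :
    ∑ j : Fin d → ι, (Matrix.of fun p q => A (j p) q).det * (Matrix.of fun p q => B (j p) q).det =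
      (d ! : R) * (Matrix.of fun p q => ∑ i, A i p * B i q).det := by
  -- Multilinearity in the rows sums over `j` and leaves rows permuted by `σ`. The resulting sign
  -- cancels the one in the Leibniz expansion of the first factor, so all `d!` permutations
  -- contribute equally.
  have key : ∀ σ : Equiv.Perm (Fin d), ∑ j : Fin d → ι, (∏ p, A (j p) (σ p)) *
      (Matrix.of fun p q => B (j p) q).det =
      (Equiv.Perm.sign σ : ℤ) * (Matrix.of fun p q => ∑ i, A i p * B i q).det := by
    intro σ
    rw [← Matrix.det_permute]
    have h := (Matrix.detRowAlternating (n := Fin d) (R := R)).toMultilinearMap.map_sum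
      (fun (p : Fin d) (i : ι) => A i (σ p) • B i)
    have h2 : ∀ j : Fin d → ι, (Matrix.detRowAlternating (n := Fin d) (R := R)).toMultilinearMap
        (fun p => A (j p) (σ p) • B (j p)) = (∏ p, A (j p) (σ p)) *
        (Matrix.of fun p q => B (j p) q).det := by
      intro j
      rw [MultilinearMap.map_smul_univ, smul_eq_mul]
      rfl
    simp only [h2] at h
    rw [← h]
    change Matrix.det _ = Matrix.det _
    congr 1
    ext p q
    simp [Finset.sum_apply]
  have h3 : ∀ j : Fin d → ι, (Matrix.of fun p q => A (j p) q).det *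
      (Matrix.of fun p q => B (j p) q).det = ∑ σ : Equiv.Perm (Fin d),
        (Equiv.Perm.sign σ : ℤ) * ((∏ p, A (j p) (σ p)) *
          (Matrix.of fun p q => B (j p) q).det) := by
    intro j
    rw [← Matrix.det_transpose, Matrix.det_apply', Finset.sum_mul]
    refine Finset.sum_congr rfl fun σ _ => ?_
    simp [mul_assoc]
  simp only [h3]
  rw [Finset.sum_comm]
  simp only [← Finset.mul_sum, key]
  rw [Finset.sum_congr rfl (g := fun _ => (Matrix.of fun p q => ∑ i, A i p * B i q).det)]
  · simp [Fintype.card_perm]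
  · intro σ _
    rw [← mul_assoc, ← Int.cast_mul, ← Units.val_mul, Int.units_mul_self]
    simp

end Determinants

/-! ### Uniqueness for first-order linear equations in power series. -/

instance : IsAddTorsionFree TimeSeries := .of_module_rat _

instance : IsAddTorsionFree (PowerSeries TimeSeries) := .of_module_rat _

section PowerSeriesODE

variable {A : Type*} [CommRing A]

theorem powerSeries_eq_zero_of_derivative_eq_mul [IsAddTorsionFree A] {f T : PowerSeries A}
    (hf : PowerSeries.derivative A f = f * T) (h0 : PowerSeries.coeff 0 f = 0) : f = 0 := by
  ext n
  rw [map_zero]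
  induction n using Nat.strong_induction_on with
  | _ n ih =>
    cases n with
    | zero => exact h0
    | succ n =>
      have h := congrArg (PowerSeries.coeff n) hf
      rw [PowerSeries.coeff_derivative, PowerSeries.coeff_mul, Finset.sum_eq_zero] at h
      · have h' : (n + 1) • PowerSeries.coeff (n + 1) f = 0 := by
          rw [nsmul_eq_mul, mul_comm]; exact_mod_cast h
        exact (nsmul_eq_zero_iff_right (Nat.succ_ne_zero n)).1 h'
      · intro x hx
        rw [Finset.HasAntidiagonal.mem_antidiagonal] at hx
        rw [ih x.1 (by omega), zero_mul]

theorem powerSeries_eq_of_derivative_eq_mul [IsAddTorsionFree A] {f g T : PowerSeries A}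
    (hf : PowerSeries.derivative A f = f * T) (hg : PowerSeries.derivative A g = g * T)
    (h0 : PowerSeries.coeff 0 f = PowerSeries.coeff 0 g) : f = g := by
  rw [← sub_eq_zero]
  refine powerSeries_eq_zero_of_derivative_eq_mul (T := T) ?_ (by rw [map_sub, h0, sub_self])
  rw [map_sub, hf, hg, sub_mul]

theorem derivative_map {B : Type*} [CommRing B] (ψ : A →+* B) (f : PowerSeries A) :
    PowerSeries.derivative B (PowerSeries.map ψ f) =
      PowerSeries.map ψ (PowerSeries.derivative A f) := by
  ext n
  simp [PowerSeries.coeff_derivative]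

end PowerSeriesODE

/-! ### The Schur generating function under `∂/∂t_k`, the Miwa shift and `t ↦ -t`. -/

/-- The generating function of the elementary Schur polynomials. -/
def schurGen : PowerSeries TimeSeries := (PowerSeries.exp ℂ).subst timeSum

theorem schurPoly_natCast_sub (j b : ℕ) :
    schurPoly ((j : ℤ) - b) = PowerSeries.coeff j (schurGen * PowerSeries.X ^ b) := by
  rw [PowerSeries.coeff_mul_X_pow', schurPoly]
  by_cases h : b ≤ j
  · have h' : ((j : ℤ) - b).toNat = j - b := by omega
    rw [if_neg (by omega), if_pos h, h', schurGen]
  · rw [if_pos (by omega), if_neg h]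

theorem derivative_schurGen :
    PowerSeries.derivative TimeSeries schurGen =
      schurGen * PowerSeries.derivative TimeSeries timeSum := by
  -- The exponential is moved to coefficients in `TimeSeries`, where the chain rule in `w` applies.
  have h : schurGen = (PowerSeries.exp TimeSeries).subst timeSum := by
    ext1 n
    rw [schurGen, PowerSeries.coeff_subst' hasSubst_timeSum,
      PowerSeries.coeff_subst' hasSubst_timeSum]
    refine finsum_congr fun d => ?_
    rw [PowerSeries.coeff_exp, PowerSeries.coeff_exp, smul_eq_mul,
      IsScalarTower.algebraMap_apply ℚ ℂ TimeSeries, Algebra.smul_def]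
  rw [h, PowerSeries.derivative_subst hasSubst_timeSum, PowerSeries.derivative_exp]

theorem coeff_zero_schurGen : PowerSeries.coeff 0 schurGen = 1 := by
  rw [schurGen, PowerSeries.coeff_subst' hasSubst_timeSum, finsum_eq_single _ 0]
  · simp
  · intro n hn
    simp [timeSum, hn]

theorem coeff_derivative_timeSum (n : ℕ) :
    PowerSeries.coeff n (PowerSeries.derivative TimeSeries timeSum) =
      MvPowerSeries.X n.succPNat * ((n : TimeSeries) + 1) := by
  rw [PowerSeries.coeff_derivative, timeSum, PowerSeries.coeff_mk, dif_pos (Nat.succ_pos n)]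
  rfl

/-- `∂/∂t_k` of a power series in `w` whose coefficients are functions of `t`. -/
def coeffDeriv (k : ℕ+) (f : PowerSeries TimeSeries) : PowerSeries TimeSeries :=
  PowerSeries.mk fun n => MvPowerSeries.pderiv ℂ k (PowerSeries.coeff n f)

theorem coeff_coeffDeriv (k : ℕ+) (f : PowerSeries TimeSeries) (n : ℕ) :
    PowerSeries.coeff n (coeffDeriv k f) = MvPowerSeries.pderiv ℂ k (PowerSeries.coeff n f) :=
  PowerSeries.coeff_mk _ _

theorem coeffDeriv_mul (k : ℕ+) (f g : PowerSeries TimeSeries) :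
    coeffDeriv k (f * g) = coeffDeriv k f * g + f * coeffDeriv k g := by
  ext1 n
  simp only [coeff_coeffDeriv, PowerSeries.coeff_mul, map_add, map_sum, Derivation.leibniz,
    smul_eq_mul, Finset.sum_add_distrib]
  rw [add_comm]
  congr 1
  exact Finset.sum_congr rfl fun _ _ => mul_comm _ _

theorem coeffDeriv_X_pow (k : ℕ+) (b : ℕ) : coeffDeriv k (PowerSeries.X ^ b) = 0 := by
  ext1 n
  rw [coeff_coeffDeriv, PowerSeries.coeff_X_pow]
  split_ifs <;> simp

theorem derivative_coeffDeriv (k : ℕ+) (f : PowerSeries TimeSeries) :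
    PowerSeries.derivative TimeSeries (coeffDeriv k f) =
      coeffDeriv k (PowerSeries.derivative TimeSeries f) := by
  ext1 n
  rw [PowerSeries.coeff_derivative, coeff_coeffDeriv, coeff_coeffDeriv,
    PowerSeries.coeff_derivative, Derivation.leibniz]
  simp [mul_comm]

/-- Formally, differentiate the exponential. Here the difference of the two sides solves `y' = y ·
timeSum'` in `w` with zero initial value. -/
theorem coeffDeriv_schurGen (k : ℕ+) :
    coeffDeriv k schurGen = schurGen * PowerSeries.X ^ (k : ℕ) := by
  rw [← sub_eq_zero]
  refine powerSeries_eq_zero_of_derivative_eq_mul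
    (T := PowerSeries.derivative TimeSeries timeSum) ?_ ?_
  · have hT : coeffDeriv k (PowerSeries.derivative TimeSeries timeSum) =
        PowerSeries.derivative TimeSeries (PowerSeries.X ^ (k : ℕ)) := by
      rw [← derivative_coeffDeriv]
      congr 1
      ext1 n
      rw [coeff_coeffDeriv, timeSum, PowerSeries.coeff_mk, PowerSeries.coeff_X_pow]
      split_ifs with h1 h2 h2
      · subst h2
        have : Nat.toPNat (k : ℕ) h1 = k := PNat.coe_injective rfl
        rw [this, MvPowerSeries.pderiv_X_self]
      · exact MvPowerSeries.pderiv_X_of_ne fun h => h2 (by rw [← h]; rfl)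
      · exact absurd k.pos (by omega)
      · simp
    rw [map_sub, derivative_coeffDeriv, derivative_schurGen, coeffDeriv_mul, hT,
      Derivation.leibniz, derivative_schurGen]
    simp only [smul_eq_mul]
    ring
  · rw [map_sub, coeff_coeffDeriv, coeff_zero_schurGen, PowerSeries.coeff_mul_X_pow',
      if_neg (by have := k.pos; omega)]
    simp

theorem coeffDeriv_schurGen_mul_X_pow (k : ℕ+) (b : ℕ) :
    coeffDeriv k (schurGen * PowerSeries.X ^ b) = schurGen * PowerSeries.X ^ (b + k) := by
  rw [coeffDeriv_mul, coeffDeriv_X_pow, coeffDeriv_schurGen, mul_zero, add_zero, mul_assoc,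
    ← pow_add, add_comm b]

/-- The ring homomorphism `f ↦ f(t - [u])` into power series in `u` over functions of `t`. -/
def miwaHom : TimeSeries →+* PowerSeries TimeSeries :=
  ((MvPowerSeries.optionEquivLeft ℕ+ ℂ).toAlgHom.toRingHom).comp
    (MvPowerSeries.substAlgHom hasSubst_miwa).toRingHom

theorem miwaHom_apply (f : TimeSeries) :
    miwaHom f = MvPowerSeries.optionEquivLeft ℕ+ ℂ (miwaShift f) := by
  rw [miwaShift, ← MvPowerSeries.coe_substAlgHom hasSubst_miwa]
  rfl

theorem coeff_miwaHom (f : TimeSeries) (i : ℕ) : PowerSeries.coeff i (miwaHom f)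
    = miwaCoeff f i := by
  ext m
  rw [miwaHom_apply, MvPowerSeries.coeff_coeff_optionEquivLeft]
  rfl

theorem miwaHom_C (r : ℂ) : miwaHom (MvPowerSeries.C r) = PowerSeries.C (MvPowerSeries.C r) := by
  rw [miwaHom_apply, miwaShift, MvPowerSeries.subst_C, MvPowerSeries.optionEquivLeft_C]

theorem miwaHom_X (k : ℕ+) : miwaHom (MvPowerSeries.X k) = PowerSeries.C (MvPowerSeries.X k) -
    PowerSeries.C (MvPowerSeries.C (1 / ((k : ℕ) : ℂ))) * PowerSeries.X ^ (k : ℕ) := by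
  rw [miwaHom_apply, miwaShift, MvPowerSeries.subst_X hasSubst_miwa, map_sub,
    MvPowerSeries.smul_eq_C_mul, map_mul, map_pow, MvPowerSeries.optionEquivLeft_X_some,
    MvPowerSeries.optionEquivLeft_X_none, MvPowerSeries.optionEquivLeft_C]

/-- `∑_{j ≥ 1} u^j w^{j-1}`. -/
def geomGen : PowerSeries (PowerSeries TimeSeries) :=
  PowerSeries.mk fun n => PowerSeries.X ^ (n + 1)

theorem geomGen_mul : geomGen * (1 - PowerSeries.C PowerSeries.X * PowerSeries.X) =
    PowerSeries.C PowerSeries.X := by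
  ext1 n
  rw [mul_sub, mul_one, ← mul_assoc, map_sub, geomGen]
  cases n with
  | zero => simp
  | succ n =>
    rw [PowerSeries.coeff_succ_mul_X, PowerSeries.coeff_mul_C, PowerSeries.coeff_mk,
      PowerSeries.coeff_mk, PowerSeries.coeff_C]
    simp [pow_succ]

/-- The factors `1/k` in `[u]` cancel against the derivative of `w^k`, leaving a geometric series.
-/
theorem map_miwaHom_derivative_timeSum :
    PowerSeries.map miwaHom (PowerSeries.derivative TimeSeries timeSum) =
      PowerSeries.map PowerSeries.C (PowerSeries.derivative TimeSeries timeSum) - geomGen := by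
  ext1 n
  rw [map_sub, PowerSeries.coeff_map, PowerSeries.coeff_map, coeff_derivative_timeSum, geomGen,
    PowerSeries.coeff_mk, map_mul, miwaHom_X, map_mul]
  have h : (PowerSeries.C (MvPowerSeries.C (1 / (((n.succPNat : ℕ+) : ℕ) : ℂ)) : TimeSeries)) *
      ((n : PowerSeries TimeSeries) + 1) = 1 := by
    have h2 : ((n : PowerSeries TimeSeries) + 1) =
        PowerSeries.C (MvPowerSeries.C ((n : ℂ) + 1) : TimeSeries) := by simp
    rw [h2, ← map_mul, ← map_mul]
    have : (n : ℂ) + 1 ≠ 0 := by exact_mod_cast Nat.succ_ne_zero n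
    simp [this]
  have h3 : ((n.succPNat : ℕ+) : ℕ) = n + 1 := rfl
  simp only [map_add, map_natCast, map_one]
  rw [h3] at h ⊢
  linear_combination (-PowerSeries.X ^ (n + 1)) * h

theorem negTimes_X (k : ℕ+) : negTimes (MvPowerSeries.X k) = - MvPowerSeries.X k := by
  classical
  ext m
  rw [negTimes, MvPowerSeries.coeff_rescale, map_neg, MvPowerSeries.coeff_X]
  split_ifs with h
  · subst h; simp
  · simp

/-- `negTimes` as a ring homomorphism. -/
def negHom : TimeSeries →+* TimeSeries := MvPowerSeries.rescale (fun _ => (-1 : ℂ))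

theorem map_negHom_derivative_timeSum :
    PowerSeries.map negHom (PowerSeries.derivative TimeSeries timeSum) =
      - PowerSeries.derivative TimeSeries timeSum := by
  ext1 n
  rw [map_neg, PowerSeries.coeff_map, coeff_derivative_timeSum, map_mul]
  change negTimes _ * _ = _
  rw [negTimes_X]
  simp only [map_add, map_natCast, map_one]
  ring

theorem derivative_map_schurGen {B : Type*} [CommRing B] (ψ : TimeSeries →+* B) :
    PowerSeries.derivative B (PowerSeries.map ψ schurGen) = PowerSeries.map ψ schurGen *
      PowerSeries.map ψ (PowerSeries.derivative TimeSeries timeSum) := by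
  rw [derivative_map, derivative_schurGen, map_mul]

theorem derivative_mul {B : Type*} [CommRing B] (f g : PowerSeries B) :
    PowerSeries.derivative B (f * g) =
      f * PowerSeries.derivative B g + g * PowerSeries.derivative B f :=
  Derivation.leibniz _ _ _

theorem constantCoeff_map_schurGen {B : Type*} [CommRing B] (ψ : TimeSeries →+* B) :
    PowerSeries.constantCoeff (PowerSeries.map ψ schurGen) = 1 := by
  rw [← PowerSeries.coeff_zero_eq_constantCoeff_apply, PowerSeries.coeff_map, coeff_zero_schurGen,
    map_one]

theorem derivative_one_sub_C_mul_X {B : Type*} [CommRing B] (u : B) :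
    PowerSeries.derivative B (1 - PowerSeries.C u * PowerSeries.X) = - PowerSeries.C u := by
  rw [map_sub, Derivation.leibniz]
  simp

/-- This is `exp (-∑ (uw)^j / j) = 1 - uw`, obtained by comparing logarithmic derivatives in `w`. -/
theorem map_miwaHom_schurGen :
    PowerSeries.map miwaHom schurGen = PowerSeries.map PowerSeries.C schurGen *
      (1 - PowerSeries.C PowerSeries.X * PowerSeries.X) := by
  refine powerSeries_eq_of_derivative_eq_mul (derivative_map_schurGen _) ?_ ?_
  · rw [derivative_mul, derivative_map_schurGen, map_miwaHom_derivative_timeSum,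
      derivative_one_sub_C_mul_X]
    linear_combination PowerSeries.map PowerSeries.C schurGen * geomGen_mul
  · simp only [PowerSeries.coeff_zero_eq_constantCoeff_apply, map_mul, constantCoeff_map_schurGen]
    simp

/-- After the sign change the argument is `-t + [u]`, so the same factor `1 - uw` appears inverted.
-/
theorem map_miwaHom_negHom_schurGen :
    PowerSeries.map (miwaHom.comp negHom) schurGen *
      (1 - PowerSeries.C PowerSeries.X * PowerSeries.X) =
    PowerSeries.map (PowerSeries.C.comp negHom) schurGen := by
  refine powerSeries_eq_of_derivative_eq_mul ?_ (derivative_map_schurGen _) ?_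
  · rw [derivative_mul, derivative_map_schurGen, derivative_one_sub_C_mul_X]
    simp only [PowerSeries.map_comp, RingHom.comp_apply,
      map_negHom_derivative_timeSum, map_neg, map_miwaHom_derivative_timeSum]
    linear_combination PowerSeries.map miwaHom (PowerSeries.map negHom schurGen) * geomGen_mul
  · simp only [PowerSeries.coeff_zero_eq_constantCoeff_apply, map_mul, constantCoeff_map_schurGen]
    simp

/-! ### Weight filtration and termwise operations on infinite sums. -/

/-- The ideal of series without terms of weight less than `N`. -/
def weightIdeal (N : ℕ) : Ideal TimeSeries where
  carrier := {f | ∀ m, timeWeight m < N → MvPowerSeries.coeff m f = 0}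
  add_mem' {f g} hf hg m hm := by rw [map_add, hf m hm, hg m hm, add_zero]
  zero_mem' m _ := map_zero _
  smul_mem' f g hg m hm := by
    classical
    rw [smul_eq_mul, MvPowerSeries.coeff_mul]
    refine Finset.sum_eq_zero fun y hy => ?_
    rw [Finset.HasAntidiagonal.mem_antidiagonal] at hy
    have hw : timeWeight y.1 + timeWeight y.2 = timeWeight m := by
      rw [← hy]; simp [timeWeight]
    rw [hg _ (by omega), mul_zero]

theorem coeff_eq_of_sub_mem_weightIdeal {N : ℕ} {f g : TimeSeries} (h : f - g ∈ weightIdeal N)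
    {m : ℕ+ →₀ ℕ} (hm : timeWeight m < N) :
    MvPowerSeries.coeff m f = MvPowerSeries.coeff m g := by
  have := h m hm
  rwa [map_sub, sub_eq_zero] at this

theorem det_mem_of_row_mem {R : Type*} [CommRing R] (I : Ideal R) {d : ℕ}
    (A : Matrix (Fin d) (Fin d) R) (p : Fin d) (h : ∀ q, A p q ∈ I) : A.det ∈ I := by
  rw [← Ideal.Quotient.eq_zero_iff_mem, RingHom.map_det]
  exact Matrix.det_eq_zero_of_row_eq_zero p fun q => Ideal.Quotient.eq_zero_iff_mem.2 (h q)

theorem det_sub_det_mem {R : Type*} [CommRing R] (I : Ideal R) {d : ℕ}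
    (A B : Matrix (Fin d) (Fin d) R) (h : ∀ p q, A p q - B p q ∈ I) : A.det - B.det ∈ I := by
  rw [← Ideal.Quotient.eq, RingHom.map_det, RingHom.map_det]
  congr 1
  ext p q
  exact Ideal.Quotient.eq.2 (h p q)

/-- The shifted elementary Schur polynomial `h_{j-b}`. -/
def schurShift (b j : ℕ) : TimeSeries := PowerSeries.coeff j (schurGen * PowerSeries.X ^ b)

theorem schurShift_mem (b j : ℕ) : schurShift b j ∈ weightIdeal (j - b) := by
  intro m hm
  rw [schurShift, ← schurPoly_natCast_sub]
  exact coeff_schurPoly _ _ (by omega)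

/-- The series `∑_j c_j h_{j-b}(t)`. -/
def schurSeries (c : ℕ → ℂ) (b : ℕ) : TimeSeries := fun m =>
  ∑ j ∈ Finset.range (timeWeight m + b + 1), c j * MvPowerSeries.coeff m (schurShift b j)

theorem coeff_schurSeries (c : ℕ → ℂ) (b : ℕ) (m : ℕ+ →₀ ℕ) {K : ℕ} (hK : timeWeight m + b < K) :
    MvPowerSeries.coeff m (schurSeries c b) =
      ∑ j ∈ Finset.range K, c j * MvPowerSeries.coeff m (schurShift b j) := by
  have h : MvPowerSeries.coeff m (schurSeries c b) = ∑ j ∈ Finset.range (timeWeight m + b + 1),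
    c j * MvPowerSeries.coeff m (schurShift b j) := rfl
  rw [h]
  refine Finset.sum_subset (Finset.range_subset_range.2 hK) fun j _ hj => ?_
  rw [Finset.mem_range, not_lt] at hj
  rw [schurShift_mem b j m (by omega), mul_zero]

theorem schurSeries_sub_sum_mem (c : ℕ → ℂ) (b : ℕ) {N K : ℕ} (hK : N + b ≤ K) :
    schurSeries c b - ∑ j ∈ Finset.range K, c j • schurShift b j ∈ weightIdeal N := by
  intro m hm
  rw [map_sub, coeff_schurSeries c b m (K := K) (by omega), map_sum, sub_eq_zero]
  exact Finset.sum_congr rfl fun j _ => (MvPowerSeries.coeff_smul _ _ _).symm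

/-- Every coefficient of `ψ f` depends on finitely many weights of `f` only. -/
def WeightContinuous (ψ : TimeSeries →ₗ[ℂ] PowerSeries TimeSeries) : Prop :=
  ∀ (i : ℕ) (m : ℕ+ →₀ ℕ), ∃ N, ∀ f ∈ weightIdeal N,
    MvPowerSeries.coeff m (PowerSeries.coeff i (ψ f)) = 0

theorem weightIdeal_anti {N N' : ℕ} (h : N ≤ N') : weightIdeal N' ≤ weightIdeal N :=
  fun _ hf m hm => hf m (hm.trans_le h)

theorem WeightContinuous.exists_coeff_eq {ψ : TimeSeries →ₗ[ℂ] PowerSeries TimeSeries}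
    (hψ : WeightContinuous ψ) (c : ℕ → ℂ) (b i : ℕ) (m : ℕ+ →₀ ℕ) :
    ∃ K₀, ∀ K ≥ K₀, MvPowerSeries.coeff m (PowerSeries.coeff i (ψ (schurSeries c b))) =
      MvPowerSeries.coeff m (PowerSeries.coeff i
        (∑ j ∈ Finset.range K, c j • ψ (schurShift b j))) := by
  obtain ⟨N, hN⟩ := hψ i m
  refine ⟨N + b, fun K hK => ?_⟩
  have h := hN _ (schurSeries_sub_sum_mem c b hK)
  rw [map_sub, map_sub, map_sub, sub_eq_zero] at h
  rw [h, map_sum]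
  simp only [map_smul]

/-- Each coefficient sees only a finite partial sum of the three series, so a linear identity
between the `h_{j-b}` passes to `∑_j c_j h_{j-b}`. -/
theorem WeightContinuous.eq_add {ψ₁ ψ₂ ψ₃ : TimeSeries →ₗ[ℂ] PowerSeries TimeSeries}
    (h₁ : WeightContinuous ψ₁) (h₂ : WeightContinuous ψ₂) (h₃ : WeightContinuous ψ₃) {b₁ b₂ b₃ : ℕ}
    (h : ∀ j, ψ₁ (schurShift b₁ j) = ψ₂ (schurShift b₂ j) + ψ₃ (schurShift b₃ j)) (c : ℕ → ℂ) :
    ψ₁ (schurSeries c b₁) = ψ₂ (schurSeries c b₂) + ψ₃ (schurSeries c b₃) := by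
  ext i m
  obtain ⟨K₁, hK₁⟩ := h₁.exists_coeff_eq c b₁ i m
  obtain ⟨K₂, hK₂⟩ := h₂.exists_coeff_eq c b₂ i m
  obtain ⟨K₃, hK₃⟩ := h₃.exists_coeff_eq c b₃ i m
  rw [map_add, map_add, hK₁ (K₁ + K₂ + K₃) (by omega), hK₂ (K₁ + K₂ + K₃) (by omega),
    hK₃ (K₁ + K₂ + K₃) (by omega), ← map_add, ← map_add, ← Finset.sum_add_distrib]
  simp only [h, smul_add]

/-- The constants in `u`, as a linear map. -/
def constLinear : TimeSeries →ₗ[ℂ] PowerSeries TimeSeries where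
  toFun := PowerSeries.C
  map_add' := map_add _
  map_smul' r f := by
    rw [MvPowerSeries.smul_eq_C_mul, map_mul, Algebra.smul_def, PowerSeries.algebraMap_apply]
    rfl

/-- `miwaHom` as a linear map. -/
def miwaLinear : TimeSeries →ₗ[ℂ] PowerSeries TimeSeries where
  toFun := miwaHom
  map_add' := map_add _
  map_smul' r f := by
    rw [MvPowerSeries.smul_eq_C_mul, map_mul, Algebra.smul_def, miwaHom_C, PowerSeries.algebraMap_apply]
    rfl

/-- `negTimes` as a linear map. -/
def negLinear : TimeSeries →ₗ[ℂ] TimeSeries where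
  toFun := negHom
  map_add' := map_add _
  map_smul' r f := by
    ext m
    simp only [RingHom.id_apply]
    rw [negHom, MvPowerSeries.coeff_smul, MvPowerSeries.coeff_rescale, MvPowerSeries.coeff_rescale,
      MvPowerSeries.coeff_smul]
    ring

/-- Multiplication by `u`. -/
def mulXLinear : PowerSeries TimeSeries →ₗ[ℂ] PowerSeries TimeSeries :=
  LinearMap.mulLeft ℂ PowerSeries.X

theorem weightContinuous_const : WeightContinuous constLinear := fun i m =>
  ⟨timeWeight m + 1, fun f hf => by
    change MvPowerSeries.coeff m (PowerSeries.coeff i (PowerSeries.C f)) = 0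
    rw [PowerSeries.coeff_C]
    split_ifs
    · exact hf m (Nat.lt_succ_self _)
    · exact map_zero _⟩

theorem weightContinuous_miwa : WeightContinuous miwaLinear := fun i m => by
  -- With the series whose coefficients are all `1`, this finiteness says that only finitely many
  -- monomials contribute to the given coefficient after substitution, whatever the series; `N`
  -- bounds their weights.
  have hfin := MvPowerSeries.coeff_subst_finite hasSubst_miwa
    (fun _ => 1 : TimeSeries) (m.optionElim i)
  obtain ⟨N, hN⟩ := (hfin.image timeWeight).bddAbove
  refine ⟨N + 1, fun f hf => ?_⟩
  change MvPowerSeries.coeff m (PowerSeries.coeff i (miwaHom f)) = 0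
  rw [miwaHom_apply, MvPowerSeries.coeff_coeff_optionEquivLeft, miwaShift,
    MvPowerSeries.coeff_subst hasSubst_miwa]
  refine finsum_eq_zero_of_forall_eq_zero fun e => ?_
  by_cases he : timeWeight e < N + 1
  · rw [hf e he, zero_smul]
  · by_contra hne
    refine he (Nat.lt_succ_of_le (hN ⟨e, ?_, rfl⟩))
    intro h0
    apply hne
    have h1 : MvPowerSeries.coeff e (fun _ => 1 : TimeSeries) = 1 := rfl
    simp only [h1, one_smul] at h0
    rw [h0, smul_zero]

theorem WeightContinuous.mulX {ψ : TimeSeries →ₗ[ℂ] PowerSeries TimeSeries}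
    (hψ : WeightContinuous ψ) : WeightContinuous (mulXLinear ∘ₗ ψ) := fun i m => by
  cases i with
  | zero => exact ⟨0, fun f _ => by simp [mulXLinear]⟩
  | succ i =>
    obtain ⟨N, hN⟩ := hψ i m
    refine ⟨N, fun f hf => ?_⟩
    change MvPowerSeries.coeff m (PowerSeries.coeff (i + 1) (PowerSeries.X * ψ f)) = 0
    rw [PowerSeries.coeff_succ_X_mul, hN f hf]

theorem WeightContinuous.neg {ψ : TimeSeries →ₗ[ℂ] PowerSeries TimeSeries}
    (hψ : WeightContinuous ψ) : WeightContinuous (-ψ) := fun i m => by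
  obtain ⟨N, hN⟩ := hψ i m
  exact ⟨N, fun f hf => by rw [LinearMap.neg_apply, map_neg, map_neg, hN f hf, neg_zero]⟩

theorem WeightContinuous.comp_neg {ψ : TimeSeries →ₗ[ℂ] PowerSeries TimeSeries}
    (hψ : WeightContinuous ψ) : WeightContinuous (ψ ∘ₗ negLinear) := fun i m => by
  obtain ⟨N, hN⟩ := hψ i m
  refine ⟨N, fun f hf => hN _ fun e he => ?_⟩
  change MvPowerSeries.coeff e (MvPowerSeries.rescale _ f) = 0
  rw [MvPowerSeries.coeff_rescale, hf e he, mul_zero]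

theorem weightContinuous_pderiv (k : ℕ+) :
    WeightContinuous (constLinear ∘ₗ (MvPowerSeries.pderiv ℂ k : TimeSeries →ₗ[ℂ] TimeSeries)) :=
  fun i m => by
  refine ⟨timeWeight m + k + 1, fun f hf => ?_⟩
  change MvPowerSeries.coeff m (PowerSeries.coeff i
    (PowerSeries.C (MvPowerSeries.pderiv ℂ k f))) = 0
  rw [PowerSeries.coeff_C]
  split_ifs
  · rw [MvPowerSeries.coeff_pderiv, hf _ _, zero_mul]
    simp [timeWeight, Finsupp.weight_single]
  · exact map_zero _

theorem map_schurGen_mul_X_pow {B : Type*} [CommRing B] (ψ : TimeSeries →+* B) (b j : ℕ) :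
    ψ (schurShift b j) =
      PowerSeries.coeff j (PowerSeries.map ψ schurGen * PowerSeries.X ^ b) := by
  rw [schurShift, ← PowerSeries.coeff_map, map_mul, map_pow, PowerSeries.map_X]

theorem miwaHom_schurShift (b j : ℕ) : miwaHom (schurShift b j) =
    PowerSeries.C (schurShift b j) - PowerSeries.X * PowerSeries.C (schurShift (b + 1) j) := by
  rw [map_schurGen_mul_X_pow, map_schurGen_mul_X_pow, map_schurGen_mul_X_pow,
    ← PowerSeries.coeff_C_mul, ← map_sub, map_miwaHom_schurGen]
  congr 1
  ring

theorem miwaHom_negHom_schurShift (b j : ℕ) : miwaHom (negHom (schurShift b j)) =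
    PowerSeries.C (negHom (schurShift b j)) +
      PowerSeries.X * miwaHom (negHom (schurShift (b + 1) j)) := by
  have h := map_schurGen_mul_X_pow (miwaHom.comp negHom)
  have h' := map_schurGen_mul_X_pow (PowerSeries.C.comp negHom)
  simp only [RingHom.comp_apply] at h h'
  rw [h, h, h', ← PowerSeries.coeff_C_mul, ← map_add, ← map_miwaHom_negHom_schurGen]
  congr 1
  ring

theorem miwaHom_schurSeries (c : ℕ → ℂ) (b : ℕ) : miwaHom (schurSeries c b) =
    PowerSeries.C (schurSeries c b) - PowerSeries.X * PowerSeries.C (schurSeries c (b + 1)) := by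
  rw [sub_eq_add_neg]
  exact weightContinuous_miwa.eq_add weightContinuous_const weightContinuous_const.mulX.neg
    (fun j => (miwaHom_schurShift b j).trans (sub_eq_add_neg _ _)) c

/-- Since `1 - uw` is inverted here, the shifted series recurs on the right: iteration gives an
infinite series in `u` instead of two terms. -/
theorem miwaHom_negHom_schurSeries (c : ℕ → ℂ) (b : ℕ) : miwaHom (negHom (schurSeries c b)) =
    PowerSeries.C (negHom (schurSeries c b)) +
      PowerSeries.X * miwaHom (negHom (schurSeries c (b + 1))) :=
  weightContinuous_miwa.comp_neg.eq_add weightContinuous_const.comp_neg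
    weightContinuous_miwa.comp_neg.mulX (miwaHom_negHom_schurShift b) c

theorem pderiv_schurSeries (k : ℕ+) (c : ℕ → ℂ) (b : ℕ) :
    MvPowerSeries.pderiv ℂ k (schurSeries c b) = schurSeries c (b + k) := by
  have h := (weightContinuous_pderiv k).eq_add weightContinuous_const
    (ψ₃ := 0) (fun i m => ⟨0, fun f _ => by simp⟩) (b₁ := b) (b₂ := b + k) (b₃ := 0)
    (fun j => by
      rw [LinearMap.zero_apply, add_zero]
      change PowerSeries.C (MvPowerSeries.pderiv ℂ k (schurShift b j)) = PowerSeries.C _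
      rw [schurShift, ← coeff_coeffDeriv, coeffDeriv_schurGen_mul_X_pow, schurShift]) c
  rw [LinearMap.zero_apply, add_zero] at h
  exact PowerSeries.C_injective h

theorem pderiv_negHom (k : ℕ+) (f : TimeSeries) :
    MvPowerSeries.pderiv ℂ k (negHom f) = - negHom (MvPowerSeries.pderiv ℂ k f) := by
  ext m
  rw [MvPowerSeries.coeff_pderiv, map_neg, negHom, MvPowerSeries.coeff_rescale,
    MvPowerSeries.coeff_rescale, MvPowerSeries.coeff_pderiv]
  rw [Finsupp.prod_add_index' (by simp) (by intros; rw [pow_add]), Finsupp.prod_single_index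
    (by simp)]
  ring

/-! ### `Ẑ_d` as a multiple of a Wronskian. -/

/-- The coefficients of `∫ x^a W(x) ∑_j x^j h_j(t) / j! dx`. -/
def momentCoeff (M : ℕ → ℂ) (a j : ℕ) : ℂ := M (j + a) / (j ! : ℂ)

/-- The determinant of `∑_j M_{j+a} h_{j-b}(t) / j!`, `b = d - 1, …, 0`. -/
def wronskianDet (M : ℕ → ℂ) (d : ℕ) : TimeSeries :=
  (Matrix.of fun a q : Fin d => schurSeries (momentCoeff M a) (d - 1 - q)).det

theorem ZHatTerm_eq (M : ℕ → ℂ) (d : ℕ) (j : Fin d → ℕ) :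
    ZHatTerm M d j = (Matrix.of fun p q : Fin d =>
        (MvPowerSeries.C (momentCoeff M q (j p)) : TimeSeries)).det *
      (Matrix.of fun p q : Fin d => schurShift (d - 1 - q) (j p)).det := by
  have h1 : (Matrix.of fun p q : Fin d => schurPoly ((j p : ℤ) - (d : ℤ) + ((q : ℕ) + 1 : ℤ))) =
      Matrix.of fun p q : Fin d => schurShift (d - 1 - q) (j p) := by
    ext1 p q
    rw [Matrix.of_apply, Matrix.of_apply, schurShift, ← schurPoly_natCast_sub]
    congr 1
    have := q.2
    omega
  have h2 : (Matrix.of fun p q : Fin d => (MvPowerSeries.C (momentCoeff M q (j p)) :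
      TimeSeries)).det = MvPowerSeries.C ((Matrix.of fun p q : Fin d => M (j p + (q : ℕ))).det /
        (∏ k, ((j k)! : ℂ))) := by
    have := Matrix.det_mul_column (fun p : Fin d => ((j p)! : ℂ)⁻¹)
      (Matrix.of fun p q : Fin d => M (j p + (q : ℕ)))
    rw [div_eq_inv_mul, ← Finset.prod_inv_distrib, ← this, RingHom.map_det]
    congr 1
    ext1 p q
    simp [momentCoeff, div_eq_inv_mul]
  rw [ZHatTerm, h1, h2, MvPowerSeries.smul_eq_C_mul]

theorem coeff_ZHatTerm_eq_zero (M : ℕ → ℂ) (d : ℕ) (j : Fin d → ℕ) (m : ℕ+ →₀ ℕ) (p : Fin d)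
    (hp : timeWeight m + d ≤ j p) : MvPowerSeries.coeff m (ZHatTerm M d j) = 0 := by
  rw [ZHatTerm_eq]
  have hd := p.2
  refine (weightIdeal (timeWeight m + 1)).mul_mem_left _
    (det_mem_of_row_mem _ _ p fun q => ?_) m (Nat.lt_succ_self _)
  exact weightIdeal_anti (by omega) (schurShift_mem _ _)

/-- For a fixed monomial only indices below `K = timeWeight m + d` matter. Cauchy–Binet applies to
this truncation, and its determinant agrees with `wronskianDet` modulo terms of weight above that of
`m`. -/
theorem finsum_coeff_ZHatTerm (M : ℕ → ℂ) (d : ℕ) (m : ℕ+ →₀ ℕ) :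
    ∑ᶠ j : Fin d → ℕ, MvPowerSeries.coeff m (ZHatTerm M d j) =
      MvPowerSeries.coeff m ((d ! : ℂ) • wronskianDet M d) := by
  classical
  set K := timeWeight m + d with hK
  let e : (Fin d → Fin K) ↪ (Fin d → ℕ) :=
    ⟨fun j p => (j p : ℕ), fun j j' h => funext fun p => Fin.ext (congrFun h p)⟩
  rw [finsum_eq_sum_of_support_subset (s := Finset.univ.map e)]
  · rw [Finset.sum_map, ← map_sum]
    have h := sum_det_mul_det (fun (i : Fin K) (q : Fin d) =>
      (MvPowerSeries.C (momentCoeff M q i) : TimeSeries))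
      (fun (i : Fin K) (q : Fin d) => schurShift (d - 1 - q) i)
    have h' : ∀ j : Fin d → Fin K, ZHatTerm M d (e j) = _ := fun j => ZHatTerm_eq M d (e j)
    simp only [h']
    change MvPowerSeries.coeff m (∑ j : Fin d → Fin K, _) = _
    refine (congrArg _ h).trans ?_
    have hC : (d ! : ℂ) • wronskianDet M d = (d ! : TimeSeries) * wronskianDet M d := by
      rw [MvPowerSeries.smul_eq_C_mul, map_natCast]
    rw [hC]
    refine coeff_eq_of_sub_mem_weightIdeal (N := timeWeight m + 1) ?_ (Nat.lt_succ_self _)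
    rw [← mul_sub]
    refine Ideal.mul_mem_left _ _ (det_sub_det_mem _ _ _ fun p q => ?_)
    have hq := q.2
    have h3 := schurSeries_sub_sum_mem (momentCoeff M p) (d - 1 - q)
      (N := timeWeight m + 1) (K := K) (by omega)
    rw [Finset.sum_range] at h3
    rw [← neg_mem_iff, neg_sub]
    simp only [MvPowerSeries.smul_eq_C_mul] at h3
    exact h3
  · intro j hj
    rw [Finset.coe_map, Finset.coe_univ, Set.image_univ]
    refine ⟨fun p => ⟨j p, ?_⟩, rfl⟩
    by_contra hp
    exact hj (coeff_ZHatTerm_eq_zero M d j m p (by omega))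

theorem exists_ZHat_eq (C M : ℕ → ℂ) (hC : ∀ d : ℕ, 1 ≤ d → C d ≠ 0) (d : ℕ) :
    ∃ r : ℂ, r ≠ 0 ∧ ZHat C M d = r • wronskianDet M d := by
  by_cases hd : d = 0
  · subst hd
    exact ⟨1, one_ne_zero, by simp [ZHat, wronskianDet]⟩
  · have hf : (d ! : ℂ) ≠ 0 := by exact_mod_cast d.factorial_ne_zero
    have hCd := hC d (Nat.one_le_iff_ne_zero.2 hd)
    refine ⟨1 / ((d ! : ℂ) * CHat C d) * d !,
      mul_ne_zero (one_div_ne_zero (mul_ne_zero hf (one_div_ne_zero (mul_ne_zero hf hCd)))) hf, ?_⟩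
    have hZ : ZHat C M d = (1 / ((d ! : ℂ) * CHat C d)) • (fun m : ℕ+ →₀ ℕ =>
        ∑ᶠ j : Fin d → ℕ, MvPowerSeries.coeff m (ZHatTerm M d j) : TimeSeries) := if_neg hd
    rw [hZ, mul_smul]
    exact congrArg _ (funext fun m => finsum_coeff_ZHatTerm M d m)

/-! ### Determinacy of the moment problem for `W`. -/

section Moments

theorem integrable_exp_abs_mul {V : ℝ → ℝ}
    (hV : ∀ a : ℝ, Integrable fun x : ℝ => Real.exp (a * x) * V x) (a : ℝ) :
    Integrable fun x : ℝ => Real.exp |a * x| * |V x| := by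
  have hm : AEStronglyMeasurable V := by simpa using (hV 0).aestronglyMeasurable
  refine Integrable.mono' ((hV a).norm.add (hV (-a)).norm) ?_ (ae_of_all _ fun x => ?_)
  · exact (Continuous.aestronglyMeasurable (by fun_prop)).mul hm.norm
  · simp only [Pi.add_apply, norm_mul, Real.norm_eq_abs, abs_abs, Real.abs_exp]
    rw [← add_mul]
    refine mul_le_mul_of_nonneg_right ?_ (abs_nonneg _)
    have := Real.exp_pos (a * x)
    have := Real.exp_pos (-a * x)
    rcases abs_cases (a * x) with ⟨h, _⟩ | ⟨h, _⟩ <;> rw [h]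
    · linarith
    · rw [neg_mul] at *; linarith

/-- Expand the exponential and integrate term by term; `exp |s x| |V x|` dominates the partial sums.
-/
theorem integral_cexp_mul_eq_zero {V : ℝ → ℝ}
    (hV : ∀ a : ℝ, Integrable fun x : ℝ => Real.exp (a * x) * V x)
    (hmom : ∀ j : ℕ, ∫ x : ℝ, x ^ j * V x = 0) (s : ℝ) :
    ∫ x : ℝ, Complex.exp (s * x * Complex.I) * (V x : ℂ) = 0 := by
  have hm : AEStronglyMeasurable V := by simpa using (hV 0).aestronglyMeasurable
  have hmC : AEStronglyMeasurable (fun x => (V x : ℂ)) :=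
    Complex.continuous_ofReal.comp_aestronglyMeasurable hm
  have hsum : ∀ x : ℝ, HasSum (fun n : ℕ => |s * x| ^ n / (n ! : ℝ) * |V x|)
      (Real.exp |s * x| * |V x|) := fun x => by
    have := NormedSpace.expSeries_div_hasSum_exp (𝔸 := ℝ) |s * x|
    rw [← Real.exp_eq_exp_ℝ] at this
    exact this.mul_right _
  have h := hasSum_integral_of_dominated_convergence (μ := volume)
    (F := fun (n : ℕ) (x : ℝ) => (s * x * Complex.I) ^ n / (n ! : ℂ) * (V x : ℂ))
    (f := fun x : ℝ => Complex.exp (s * x * Complex.I) * (V x : ℂ))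
    (fun n x => |s * x| ^ n / (n ! : ℝ) * |V x|)
    (fun n => (Continuous.aestronglyMeasurable (by fun_prop)).mul hmC)
    (fun n => ae_of_all _ fun x => by
      simp [abs_mul])
    (ae_of_all _ fun x => (hsum x).summable)
    (by simpa only [(hsum _).tsum_eq] using integrable_exp_abs_mul hV s)
    (ae_of_all _ fun x => by
      have := NormedSpace.expSeries_div_hasSum_exp (𝔸 := ℂ) (s * x * Complex.I)
      rw [← Complex.exp_eq_exp_ℂ] at this
      exact this.mul_right _)
  have h0 : ∀ n : ℕ, ∫ x : ℝ, (s * x * Complex.I) ^ n / (n ! : ℂ) * (V x : ℂ) = 0 := by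
    intro n
    have : ∀ x : ℝ, (s * x * Complex.I) ^ n / (n ! : ℂ) * (V x : ℂ) =
        ((s * Complex.I) ^ n / (n ! : ℂ)) * ((x ^ n * V x : ℝ) : ℂ) := fun x => by
      push_cast; ring
    simp only [this]
    rw [integral_const_mul, integral_complex_ofReal, hmom]
    simp
  simp only [h0] at h
  exact h.unique hasSum_zero

theorem integral_withDensity_ofReal {V : ℝ → ℝ} (hm : AEMeasurable V) (g : ℝ → ℂ) :
    ∫ x, g x ∂(volume.withDensity fun x => ENNReal.ofReal (V x)) =
      ∫ x, ((max (V x) 0 : ℝ) : ℂ) * g x := by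
  rw [integral_withDensity_eq_integral_toReal_smul₀ hm.ennreal_ofReal
    (ae_of_all _ fun x => ENNReal.ofReal_lt_top)]
  simp only [ENNReal.toReal_ofReal', Complex.real_smul]

/-- The positive and negative parts of `V` are densities of finite measures. Their characteristic
functions agree because the Fourier transform of `V` vanishes, so the measures and hence the
densities agree. -/
theorem ae_eq_zero_of_moments_eq_zero {V : ℝ → ℝ}
    (hV : ∀ a : ℝ, Integrable fun x : ℝ => Real.exp (a * x) * V x)
    (hmom : ∀ j : ℕ, ∫ x : ℝ, x ^ j * V x = 0) : V =ᵐ[volume] 0 := by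
  have hint : Integrable V := by simpa using hV 0
  have hm : AEMeasurable V := hint.aemeasurable
  have hm' : AEMeasurable fun x => -V x := hm.neg
  have f1 : IsFiniteMeasure (volume.withDensity fun x => ENNReal.ofReal (V x)) :=
    isFiniteMeasure_withDensity_ofReal hint.2
  have f2 : IsFiniteMeasure (volume.withDensity fun x => ENNReal.ofReal (-V x)) :=
    isFiniteMeasure_withDensity_ofReal hint.neg.2
  have hbound : ∀ s x : ℝ, ‖Complex.exp (s * x * Complex.I)‖ = 1 := fun s x => by
    rw [← Complex.ofReal_mul, Complex.norm_exp_ofReal_mul_I]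
  have key : (volume.withDensity fun x => ENNReal.ofReal (V x)) =
      volume.withDensity fun x => ENNReal.ofReal (-V x) := by
    refine Measure.ext_of_charFun (funext fun s => ?_)
    rw [charFun_apply_real, charFun_apply_real, integral_withDensity_ofReal hm,
      integral_withDensity_ofReal hm', ← sub_eq_zero, ← integral_sub,
      ← integral_cexp_mul_eq_zero hV hmom s]
    · refine integral_congr_ae (ae_of_all _ fun x => ?_)
      simp only
      rw [← sub_mul, ← Complex.ofReal_sub, mul_comm]
      congr 2
      rcases le_total 0 (V x) with h | h
      · rw [max_eq_left h, max_eq_right (by linarith), sub_zero]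
      · rw [max_eq_right h, max_eq_left (by linarith), zero_sub, neg_neg]
    · refine Integrable.mul_bdd (c := 1) hint.pos_part.ofReal
        (Continuous.aestronglyMeasurable (by fun_prop)) (ae_of_all _ fun x => (hbound s x).le)
    · refine Integrable.mul_bdd (c := 1) hint.neg_part.ofReal
        (Continuous.aestronglyMeasurable (by fun_prop)) (ae_of_all _ fun x => (hbound s x).le)
  rw [withDensity_eq_iff_of_sigmaFinite hm.ennreal_ofReal hm'.ennreal_ofReal] at key
  filter_upwards [key] with x hx
  have := congrArg ENNReal.toReal hx
  simp only [ENNReal.toReal_ofReal'] at this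
  change V x = 0
  rcases le_total 0 (V x) with h | h
  · rw [max_eq_left h, max_eq_right (by linarith)] at this; exact this
  · rw [max_eq_right h, max_eq_left (by linarith)] at this; linarith

theorem integrable_exp_mul_pow_mul {W : ℝ → ℂ}
    (hW : ∀ a : ℝ, Integrable fun x : ℝ => (Real.exp (a * x) : ℂ) * W x) (a : ℝ) (j : ℕ) :
    Integrable fun x : ℝ => (Real.exp (a * x) : ℂ) * ((x : ℂ) ^ j * W x) := by
  have hm : AEStronglyMeasurable W := by simpa using (hW 0).aestronglyMeasurable
  refine Integrable.mono' (((hW (a + 1)).norm.add (hW (a - 1)).norm).const_mul (j ! : ℝ)) ?_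
    (ae_of_all _ fun x => ?_)
  · exact (Continuous.aestronglyMeasurable (by fun_prop)).mul
      ((Continuous.aestronglyMeasurable (by fun_prop)).mul hm)
  · have h1 : |x| ^ j ≤ (j ! : ℝ) * Real.exp |x| := by
      have := Real.pow_div_factorial_le_exp (x := |x|) (abs_nonneg x) j
      rwa [div_le_iff₀' (by positivity)] at this
    have h2 : Real.exp (a * x) * Real.exp |x| ≤
        Real.exp ((a + 1) * x) + Real.exp ((a - 1) * x) := by
      rw [← Real.exp_add]
      have := Real.exp_pos ((a + 1) * x)
      have := Real.exp_pos ((a - 1) * x)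
      rcases abs_cases x with ⟨h, _⟩ | ⟨h, _⟩ <;> rw [h]
      · rw [show a * x + x = (a + 1) * x by ring]; linarith
      · rw [show a * x + -x = (a - 1) * x by ring]; linarith
    simp only [Pi.add_apply, norm_mul, norm_pow, Complex.norm_real, Real.norm_eq_abs, Real.abs_exp]
    calc Real.exp (a * x) * (|x| ^ j * ‖W x‖)
        ≤ Real.exp (a * x) * ((j ! : ℝ) * Real.exp |x| * ‖W x‖) := by gcongr
      _ = (j ! : ℝ) * ((Real.exp (a * x) * Real.exp |x|) * ‖W x‖) := by ring
      _ ≤ (j ! : ℝ) * ((Real.exp ((a + 1) * x) + Real.exp ((a - 1) * x)) * ‖W x‖) := by gcongr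
      _ = _ := by ring

/-- The function `V = p W` with `p = ∑ γ_a x^a` has zero moments, so its real and imaginary parts
vanish almost everywhere; `p` has only finitely many real zeros. -/
theorem ae_eq_zero_of_sum_moment_eq_zero {W : ℝ → ℂ}
    (hW : ∀ a : ℝ, Integrable fun x : ℝ => (Real.exp (a * x) : ℂ) * W x) {d : ℕ} (γ : Fin d → ℂ)
        (hγ : γ ≠ 0)
    (h : ∀ j : ℕ, ∑ a, γ a * moment W (j + a) = 0) : W =ᵐ[volume] 0 := by
  set V : ℝ → ℂ := fun x => ∑ a, γ a * ((x : ℂ) ^ (a : ℕ) * W x) with hVdef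
  have hVint : ∀ a : ℝ, Integrable fun x : ℝ => (Real.exp (a * x) : ℂ) * V x := by
    intro a
    have : (fun x : ℝ => (Real.exp (a * x) : ℂ) * V x) = fun x : ℝ => ∑ i : Fin d,
        γ i * ((Real.exp (a * x) : ℂ) * ((x : ℂ) ^ (i : ℕ) * W x)) := by
      funext x
      rw [hVdef, Finset.mul_sum]
      exact Finset.sum_congr rfl fun i _ => by ring
    rw [this]
    exact integrable_finsetSum _ fun i _ => (integrable_exp_mul_pow_mul hW a i).const_mul _
  have hpow : ∀ j : ℕ, Integrable fun x : ℝ => (x : ℂ) ^ j * W x := fun j => by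
    simpa using integrable_exp_mul_pow_mul hW 0 j
  have hVpow : ∀ j : ℕ, (fun x : ℝ => (x : ℂ) ^ j * V x) = fun x : ℝ => ∑ i : Fin d,
      γ i * ((x : ℂ) ^ (j + i) * W x) := fun j => by
    funext x
    rw [hVdef, Finset.mul_sum]
    exact Finset.sum_congr rfl fun i _ => by ring
  have hVmom : ∀ j : ℕ, ∫ x : ℝ, (x : ℂ) ^ j * V x = 0 := by
    intro j
    rw [hVpow, integral_finsetSum _ fun i _ => (hpow _).const_mul _, ← h j]
    exact Finset.sum_congr rfl fun i _ => integral_const_mul _ _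
  have hVpi : ∀ j : ℕ, Integrable fun x : ℝ => (x : ℂ) ^ j * V x := by
    intro j
    rw [hVpow]
    exact integrable_finsetSum _ fun i _ => (hpow _).const_mul _
  have hre : (fun x => (V x).re) =ᵐ[volume] 0 := by
    refine ae_eq_zero_of_moments_eq_zero (fun a => ?_) fun j => ?_
    · simpa only [RCLike.re_eq_complex_re, Complex.re_ofReal_mul] using (hVint a).re
    · have h1 := integral_re (hVpi j)
      rw [hVmom] at h1
      simpa [← Complex.ofReal_pow] using h1
  have him : (fun x => (V x).im) =ᵐ[volume] 0 := by
    refine ae_eq_zero_of_moments_eq_zero (fun a => ?_) fun j => ?_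
    · simpa only [RCLike.im_eq_complex_im, Complex.im_ofReal_mul] using (hVint a).im
    · have h1 := integral_im (hVpi j)
      rw [hVmom] at h1
      simpa [← Complex.ofReal_pow] using h1
  set p : Polynomial ℂ := ∑ a : Fin d, Polynomial.C (γ a) * Polynomial.X ^ (a : ℕ) with hp
  have hp0 : p ≠ 0 := by
    obtain ⟨a, ha⟩ := Function.ne_iff.1 hγ
    intro h0
    apply ha
    have := congrArg (fun q => Polynomial.coeff q (a : ℕ)) h0
    simpa [hp, Polynomial.finsetSum_coeff, Polynomial.coeff_X_pow, Fin.val_inj] using this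
  have hfin : Set.Finite {x : ℝ | p.eval (x : ℂ) = 0} := by
    refine (p.roots.toFinset.finite_toSet.preimage (f := fun x : ℝ => (x : ℂ))
      Complex.ofReal_injective.injOn).subset fun z hz => ?_
    simpa [hp0] using hz
  have hae := hfin.measure_zero volume
  filter_upwards [hre, him, measure_eq_zero_iff_ae_notMem.1 hae] with x h1 h2 h3
  have hVx : V x = p.eval (x : ℂ) * W x := by
    rw [hVdef, hp, Polynomial.eval_finsetSum, Finset.sum_mul]
    refine Finset.sum_congr rfl fun i _ => ?_
    simp [mul_assoc]
  have hV0 : V x = 0 := Complex.ext h1 h2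
  rw [hVx] at hV0
  exact (mul_eq_zero.1 hV0).resolve_left h3

end Moments

/-! ### Vanishing Wronskians of formal power series. -/

section Wronskian

/-- Comparing lowest-order terms shows that every nonzero solution `f` has the order of `g`.
Choosing `r` to cancel the coefficient of `f` at that order makes `f - r g` a solution that cannot
have this order, hence zero. -/
theorem exists_eq_C_mul_of_derivative_mul_eq {f g : PowerSeries ℂ} (hg : g ≠ 0)
    (h : PowerSeries.derivative ℂ f * g = f * PowerSeries.derivative ℂ g) :
    ∃ r : ℂ, f = PowerSeries.C r * g := by
  have key : ∀ f' : PowerSeries ℂ, f' ≠ 0 →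
      PowerSeries.derivative ℂ f' * g = f' * PowerSeries.derivative ℂ g →
      f'.order.toNat = g.order.toNat := by
    intro f' hf' h'
    -- The Euler operator multiplies the leading coefficient by the order.
    have euler : ∀ ψ : PowerSeries ℂ, PowerSeries.X * PowerSeries.derivative ℂ ψ =
        PowerSeries.X ^ ψ.order.toNat * ((ψ.order.toNat : PowerSeries ℂ) * ψ.divXPowOrder +
          PowerSeries.X * PowerSeries.derivative ℂ ψ.divXPowOrder) := by
      intro ψ
      conv_lhs => rw [← PowerSeries.X_pow_order_mul_divXPowOrder (f := ψ)]
      rw [derivative_mul, PowerSeries.derivative_pow, PowerSeries.derivative_X]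
      cases ψ.order.toNat with
      | zero => simp
      | succ n => rw [Nat.add_sub_cancel]; ring
    have e1 := euler f'
    have e2 := euler g
    have x1 := PowerSeries.X_pow_order_mul_divXPowOrder (f := f')
    have x2 := PowerSeries.X_pow_order_mul_divXPowOrder (f := g)
    have h1 : PowerSeries.X ^ (f'.order.toNat + g.order.toNat) *
        (((f'.order.toNat : PowerSeries ℂ) * f'.divXPowOrder +
          PowerSeries.X * PowerSeries.derivative ℂ f'.divXPowOrder) * g.divXPowOrder) =
        PowerSeries.X ^ (f'.order.toNat + g.order.toNat) *
        (f'.divXPowOrder * ((g.order.toNat : PowerSeries ℂ) * g.divXPowOrder +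
          PowerSeries.X * PowerSeries.derivative ℂ g.divXPowOrder)) := by
      have hl : PowerSeries.X ^ (f'.order.toNat + g.order.toNat) *
        (((f'.order.toNat : PowerSeries ℂ) * f'.divXPowOrder +
          PowerSeries.X * PowerSeries.derivative ℂ f'.divXPowOrder) * g.divXPowOrder) =
          (PowerSeries.X * PowerSeries.derivative ℂ f') * g := by
        rw [e1]; conv_rhs => rw [← x2]
        ring
      have hr : PowerSeries.X ^ (f'.order.toNat + g.order.toNat) *
        (f'.divXPowOrder * ((g.order.toNat : PowerSeries ℂ) * g.divXPowOrder +
          PowerSeries.X * PowerSeries.derivative ℂ g.divXPowOrder)) =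
          f' * (PowerSeries.X * PowerSeries.derivative ℂ g) := by
        rw [e2]; conv_rhs => rw [← x1]
        ring
      rw [hl, hr, mul_assoc, h']
      ring
    have h2 := mul_left_cancel₀ (pow_ne_zero _ PowerSeries.X_ne_zero) h1
    have h3 := congrArg PowerSeries.constantCoeff h2
    simp only [map_add, map_mul, map_natCast, PowerSeries.constantCoeff_X, zero_mul, add_zero] at h3
    have n1 : PowerSeries.constantCoeff f'.divXPowOrder ≠ 0 := fun h0 =>
      hf' (PowerSeries.constantCoeff_divXPowOrder_eq_zero_iff.1 h0)
    have n2 : PowerSeries.constantCoeff g.divXPowOrder ≠ 0 := fun h0 =>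
      hg (PowerSeries.constantCoeff_divXPowOrder_eq_zero_iff.1 h0)
    have h4 : ((f'.order.toNat : ℂ) - g.order.toNat) * (PowerSeries.constantCoeff f'.divXPowOrder *
        PowerSeries.constantCoeff g.divXPowOrder) = 0 := by linear_combination h3
    have h5 := (mul_eq_zero.1 h4).resolve_right (mul_ne_zero n1 n2)
    exact_mod_cast sub_eq_zero.1 h5
  have hgc : PowerSeries.coeff g.order.toNat g ≠ 0 := by
    rw [← PowerSeries.constantCoeff_divXPowOrder]
    exact fun h0 => hg (PowerSeries.constantCoeff_divXPowOrder_eq_zero_iff.1 h0)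
  refine ⟨PowerSeries.coeff g.order.toNat f / PowerSeries.coeff g.order.toNat g, ?_⟩
  set r := PowerSeries.coeff g.order.toNat f / PowerSeries.coeff g.order.toNat g with hr
  by_contra hne
  have hne' : f - PowerSeries.C r * g ≠ 0 := sub_ne_zero.2 hne
  have ho := key _ hne' (by
    rw [map_sub, derivative_mul, PowerSeries.derivative_C]
    linear_combination h)
  have h0 : PowerSeries.coeff (f - PowerSeries.C r * g).order.toNat (f - PowerSeries.C r * g)
      = 0 := by
    rw [ho, map_sub, PowerSeries.coeff_C_mul, hr, div_mul_cancel₀ _ hgc, sub_self]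
  rw [← PowerSeries.constantCoeff_divXPowOrder] at h0
  exact hne' (PowerSeries.constantCoeff_divXPowOrder_eq_zero_iff.1 h0)

/-- If the Wronskian of the first `d` series is nonzero, a kernel vector `c` of the larger matrix is
unique up to scaling. Its derivative satisfies the first `d` relations too, so the ratios of its
entries are constants. Differentiating the resulting constant relation gives all `b`. -/
theorem exists_sum_C_mul_eq_zero_of_wronskian_eq_zero (f : ℕ → ℕ → PowerSeries ℂ)
    (hf : ∀ a b, PowerSeries.derivative ℂ (f a b) = f a (b + 1)) (d : ℕ)
    (h : (Matrix.of fun a b : Fin d => f a b).det = 0) :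
    ∃ γ : Fin d → ℂ, γ ≠ 0 ∧ ∀ b, ∑ a, PowerSeries.C (γ a) * f a b = 0 := by
  induction d with
  | zero => simp at h
  | succ d ih =>
    by_cases hd : (Matrix.of fun a b : Fin d => f a b).det = 0
    · obtain ⟨γ, hγ, hsum⟩ := ih hd
      refine ⟨Fin.snoc γ 0, fun h0 => hγ ?_, fun b => ?_⟩
      · funext a
        have := congrFun h0 a.castSucc
        simpa using this
      · rw [Fin.sum_univ_castSucc]
        simpa using hsum b
    have inj : ∀ v : Fin d → PowerSeries ℂ, (∀ b < d, ∑ a, v a * f a b = 0) → v = 0 := by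
      intro v hv
      by_contra hne
      refine hd (Matrix.exists_vecMul_eq_zero_iff.1 ⟨v, hne, ?_⟩)
      funext b
      exact hv b b.2
    obtain ⟨c, hc0, hc⟩ := Matrix.exists_vecMul_eq_zero_iff.2 h
    have hc : ∀ b ≤ d, ∑ a : Fin (d + 1), c a * f a b = 0 := fun b hb =>
      congrFun hc ⟨b, Nat.lt_succ_of_le hb⟩
    have hlast : c (Fin.last d) ≠ 0 := by
      intro h0
      have hv : (fun a : Fin d => c a.castSucc) = 0 := by
        refine inj _ fun b hb => ?_
        have := hc b hb.le
        rw [Fin.sum_univ_castSucc, h0, zero_mul, add_zero] at this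
        exact this
      apply hc0
      funext a
      refine Fin.lastCases h0 (fun a => ?_) a
      exact congrFun hv a
    have hc' : ∀ b < d, ∑ a : Fin (d + 1), PowerSeries.derivative ℂ (c a) * f a b = 0 := by
      intro b hb
      have h1 := congrArg (PowerSeries.derivative ℂ) (hc b hb.le)
      rw [map_sum, map_zero] at h1
      simp only [derivative_mul, hf, Finset.sum_add_distrib] at h1
      rw [hc (b + 1) hb, zero_add] at h1
      simpa only [mul_comm] using h1
    have hconst : ∀ a : Fin d, ∃ r, c a.castSucc = PowerSeries.C r * c (Fin.last d) := by
      -- These are the numerators of the derivatives of `c_a / c_d`; the combination eliminates the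
      -- last series.
      have hv : (fun a : Fin d => PowerSeries.derivative ℂ (c a.castSucc) * c (Fin.last d) -
          c a.castSucc * PowerSeries.derivative ℂ (c (Fin.last d))) = 0 := by
        refine inj _ fun b hb => ?_
        have h1 := hc b hb.le
        have h2 := hc' b hb
        rw [Fin.sum_univ_castSucc] at h1 h2
        have h3 : ∀ a : Fin d, (PowerSeries.derivative ℂ (c a.castSucc) * c (Fin.last d) -
          c a.castSucc * PowerSeries.derivative ℂ (c (Fin.last d))) * f a b =
          c (Fin.last d) * (PowerSeries.derivative ℂ (c a.castSucc) * f a b) -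
          PowerSeries.derivative ℂ (c (Fin.last d)) * (c a.castSucc * f a b) := fun a => by ring
        simp only [h3]
        rw [Finset.sum_sub_distrib, ← Finset.mul_sum, ← Finset.mul_sum]
        simp only [Fin.val_castSucc, Fin.val_last] at h1 h2
        linear_combination c (Fin.last d) * h2 - PowerSeries.derivative ℂ (c (Fin.last d)) * h1
      intro a
      exact exists_eq_C_mul_of_derivative_mul_eq hlast (sub_eq_zero.1 (congrFun hv a))
    choose r hr using hconst
    have hzero : ∑ a : Fin (d + 1), PowerSeries.C ((Fin.snoc r 1 : Fin (d + 1) → ℂ) a) * f a 0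
        = 0 := by
      have h1 := hc 0 (Nat.zero_le _)
      rw [Fin.sum_univ_castSucc] at h1 ⊢
      simp only [hr, Fin.snoc_castSucc, Fin.snoc_last, map_one, one_mul] at h1 ⊢
      refine (mul_eq_zero.1 (?_ : c (Fin.last d) * _ = 0)).resolve_left hlast
      rw [mul_add, Finset.mul_sum, ← h1]
      congr 1
      exact Finset.sum_congr rfl fun a _ => by simp only [Fin.val_castSucc]; ring
    refine ⟨Fin.snoc r 1, fun h0 => ?_, fun b => ?_⟩
    · have := congrFun h0 (Fin.last d)
      simp at this
    · induction b with
      | zero => exact hzero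
      | succ b ihb =>
        have h1 := congrArg (PowerSeries.derivative ℂ) ihb
        rw [map_sum, map_zero] at h1
        simpa only [derivative_mul, hf, PowerSeries.derivative_C, mul_zero, add_zero] using h1

end Wronskian

/-! ### Nonvanishing of `wronskianDet`. -/

/-- The restriction of a series in `t` to the `t_1` axis. -/
def restrictFirst : TimeSeries →+* PowerSeries ℂ :=
  (MvPowerSeries.killCompl (R := ℂ)
    (⟨fun _ => 1, fun _ _ _ => rfl⟩ : Unit ↪ ℕ+)).toRingHom

theorem coeff_restrictFirst (f : TimeSeries) (n : ℕ) :
    PowerSeries.coeff n (restrictFirst f) = MvPowerSeries.coeff (Finsupp.single 1 n) f := by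
  have h := MvPowerSeries.coeff_killCompl (R := ℂ)
    (e := (⟨fun _ => 1, fun _ _ _ => rfl⟩ : Unit ↪ ℕ+)) f (Finsupp.single () n)
  rw [Finsupp.embDomain_single] at h
  exact h

theorem derivative_restrictFirst (f : TimeSeries) :
    PowerSeries.derivative ℂ (restrictFirst f) = restrictFirst (MvPowerSeries.pderiv ℂ 1 f) := by
  ext n
  rw [PowerSeries.coeff_derivative, coeff_restrictFirst, coeff_restrictFirst,
    MvPowerSeries.coeff_pderiv, ← Finsupp.single_add]
  simp

/-- At `t = 0` the polynomial `h_{j-b}` is `1` for `j = b` and `0` otherwise. -/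
theorem constantCoeff_restrictFirst_schurSeries (c : ℕ → ℂ) (b : ℕ) :
    PowerSeries.coeff 0 (restrictFirst (schurSeries c b)) = c b := by
  rw [coeff_restrictFirst, Finsupp.single_zero, coeff_schurSeries c b 0 (K := b + 1)
    (by simp [timeWeight]), Finset.sum_eq_single b]
  · rw [schurShift, PowerSeries.coeff_mul_X_pow', if_pos le_rfl, Nat.sub_self, coeff_zero_schurGen]
    simp
  · intro j hj hne
    rw [Finset.mem_range] at hj
    rw [schurShift, PowerSeries.coeff_mul_X_pow', if_neg (by omega), map_zero, mul_zero]
  · simp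

theorem wronskianDet_ne_zero {W : ℝ → ℂ}
    (hW : ∀ a : ℝ, Integrable fun x : ℝ => (Real.exp (a * x) : ℂ) * W x)
    (hW0 : ¬ W =ᵐ[volume] 0) (d : ℕ) : wronskianDet (moment W) d ≠ 0 := by
  intro h0
  have h1 := congrArg restrictFirst h0
  rw [wronskianDet, RingHom.map_det, map_zero] at h1
  -- `wronskianDet` lists derivatives in decreasing order; reversing the columns costs only a sign.
  have h2 : (Matrix.of fun a b : Fin d =>
      restrictFirst (schurSeries (momentCoeff (moment W) a) b)).det = 0 := by
    have h3 := Matrix.det_permute' Fin.revPerm (Matrix.of fun a b : Fin d =>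
      restrictFirst (schurSeries (momentCoeff (moment W) a) b))
    have h4 : (Matrix.of fun a b : Fin d =>
        restrictFirst (schurSeries (momentCoeff (moment W) a) b)).submatrix id Fin.revPerm =
        restrictFirst.mapMatrix (Matrix.of fun a q : Fin d =>
          schurSeries (momentCoeff (moment W) a) (d - 1 - q)) := by
      ext1 a q
      have : d - ((q : ℕ) + 1) = d - 1 - q := by omega
      simp [Fin.val_rev, this]
    rw [h4, h1] at h3
    refine (mul_eq_zero.1 h3.symm).resolve_left fun h5 => ?_
    rcases Int.units_eq_one_or (Equiv.Perm.sign (Fin.revPerm (n := d))) with h6 | h6 <;>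
      simp [h6] at h5
  obtain ⟨γ, hγ, hsum⟩ := exists_sum_C_mul_eq_zero_of_wronskian_eq_zero
    (fun a b => restrictFirst (schurSeries (momentCoeff (moment W) a) b))
    (fun a b => by rw [derivative_restrictFirst, pderiv_schurSeries]; rfl) d h2
  refine hW0 (ae_eq_zero_of_sum_moment_eq_zero hW γ hγ fun j => ?_)
  have h3 := congrArg (PowerSeries.coeff 0) (hsum j)
  rw [map_sum, map_zero] at h3
  simp only [PowerSeries.coeff_C_mul, constantCoeff_restrictFirst_schurSeries, momentCoeff] at h3
  have hj : (j ! : ℂ) ≠ 0 := by exact_mod_cast j.factorial_ne_zero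
  rw [← mul_eq_zero_iff_right (inv_ne_zero hj), Finset.sum_mul, ← h3]
  exact Finset.sum_congr rfl fun a _ => by ring

/-! ### `timeDeriv` as a derivation of the fraction field. -/

section TimeDeriv

theorem algebraMap_timeField_injective : Function.Injective (algebraMap TimeSeries TimeField) :=
  IsFractionRing.injective TimeSeries TimeField

theorem algebraMap_timeField_ne_zero {b : TimeSeries} (hb : b ≠ 0) :
    algebraMap TimeSeries TimeField b ≠ 0 :=
  fun h => hb (algebraMap_timeField_injective (by rw [h, map_zero]))

theorem exists_eq_div (x : TimeField) : ∃ a b : TimeSeries, b ≠ 0 ∧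
    x = algebraMap TimeSeries TimeField a / algebraMap TimeSeries TimeField b := by
  obtain ⟨a, b, hb, h⟩ := IsFractionRing.div_surjective (A := TimeSeries) x
  exact ⟨a, b, nonZeroDivisors.ne_zero hb, h.symm⟩

theorem timeDeriv_add (k : ℕ+) (x y : TimeField) :
    timeDeriv k (x + y) = timeDeriv k x + timeDeriv k y := by
  obtain ⟨a, b, hb, rfl⟩ := exists_eq_div x
  obtain ⟨c, d, hd, rfl⟩ := exists_eq_div y
  have hb' := algebraMap_timeField_ne_zero hb
  have hd' := algebraMap_timeField_ne_zero hd
  rw [div_add_div _ _ hb' hd', ← map_mul, ← map_mul, ← map_mul, ← map_add,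
    timeDeriv_div k _ _ (mul_ne_zero hb hd), timeDeriv_div k _ _ hb, timeDeriv_div k _ _ hd]
  simp only [map_add, map_mul, map_sub, Derivation.leibniz, smul_eq_mul]
  field_simp
  ring

theorem timeDeriv_mul (k : ℕ+) (x y : TimeField) :
    timeDeriv k (x * y) = timeDeriv k x * y + x * timeDeriv k y := by
  obtain ⟨a, b, hb, rfl⟩ := exists_eq_div x
  obtain ⟨c, d, hd, rfl⟩ := exists_eq_div y
  have hb' := algebraMap_timeField_ne_zero hb
  have hd' := algebraMap_timeField_ne_zero hd
  rw [div_mul_div_comm, ← map_mul, ← map_mul, timeDeriv_div k _ _ (mul_ne_zero hb hd),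
    timeDeriv_div k _ _ hb, timeDeriv_div k _ _ hd]
  simp only [map_add, map_mul, map_sub, Derivation.leibniz, smul_eq_mul]
  field_simp
  ring

theorem timeDeriv_algebraMap (k : ℕ+) (f : TimeSeries) :
    timeDeriv k (algebraMap TimeSeries TimeField f) =
      algebraMap TimeSeries TimeField (MvPowerSeries.pderiv ℂ k f) := by
  have h := timeDeriv_div k f 1 one_ne_zero
  simpa using h

/-- `timeDeriv` as an additive map. -/
def timeDerivHom (k : ℕ+) : TimeField →+ TimeField :=
  AddMonoidHom.mk' (timeDeriv k) (timeDeriv_add k)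

theorem timeDeriv_zero (k : ℕ+) : timeDeriv k 0 = 0 := map_zero (timeDerivHom k)

theorem timeDeriv_one (k : ℕ+) : timeDeriv k 1 = 0 := by
  have := timeDeriv_algebraMap k 1
  simpa using this

theorem timeDeriv_sum (k : ℕ+) {ι : Type*} (s : Finset ι) (f : ι → TimeField) :
    timeDeriv k (∑ i ∈ s, f i) = ∑ i ∈ s, timeDeriv k (f i) := map_sum (timeDerivHom k) f s

end TimeDeriv

/-! ### The ring of matrices with finitely many superdiagonals. -/

section BandMatrices

/-- The entries of `A` vanish above the `N`-th diagonal. -/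
def IsBand (N : ℤ) (A : BiMatrix) : Prop := ∀ n m : ℤ, n + N < m → A n m = 0

theorem IsBand.mono {N N' : ℤ} {A : BiMatrix} (hA : IsBand N A) (h : N ≤ N') : IsBand N' A :=
  fun n m hm => hA n m (by omega)

theorem biMul_eq_sum {N N' : ℤ} {A B : BiMatrix} (hA : IsBand N A) (hB : IsBand N' B)
    {n l lo hi : ℤ}
    (hlo : lo ≤ l - N') (hhi : n + N ≤ hi) :
    biMul A B n l = ∑ m ∈ Finset.Icc lo hi, A n m * B m l := by
  refine finsum_eq_sum_of_support_subset _ fun m hm => ?_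
  rw [Finset.coe_Icc, Set.mem_Icc]
  by_contra hcon
  apply hm
  rcases not_and_or.1 hcon with h | h
  · simp only [hB m l (by omega), mul_zero]
  · simp only [hA n m (by omega), zero_mul]

theorem IsBand.biMul {N N' : ℤ} {A B : BiMatrix} (hA : IsBand N A) (hB : IsBand N' B) :
    IsBand (N + N') (biMul A B) := fun n l h => by
  rw [biMul_eq_sum hA hB le_rfl le_rfl, Finset.Icc_eq_empty (by omega), Finset.sum_empty]

theorem biMul_assoc {N₁ N₂ N₃ : ℤ} {A B C : BiMatrix} (hA : IsBand N₁ A) (hB : IsBand N₂ B)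
    (hC : IsBand N₃ C) : biMul (biMul A B) C = biMul A (biMul B C) := by
  funext n l
  rw [biMul_eq_sum (hA.biMul hB) hC (lo := l - N₃) (hi := n + (N₁ + N₂)) le_rfl le_rfl,
    biMul_eq_sum hA (hB.biMul hC) (lo := l - (N₂ + N₃)) (hi := n + N₁) le_rfl le_rfl]
  have h1 : ∀ m ∈ Finset.Icc (l - N₃) (n + (N₁ + N₂)), biMul A B n m * C m l =
      ∑ p ∈ Finset.Icc (l - (N₂ + N₃)) (n + N₁), A n p * B p m * C m l := fun m hm => by
    rw [Finset.mem_Icc] at hm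
    rw [biMul_eq_sum hA hB (lo := l - (N₂ + N₃)) (by omega) le_rfl, Finset.sum_mul]
  have h2 : ∀ p ∈ Finset.Icc (l - (N₂ + N₃)) (n + N₁), A n p * biMul B C p l =
      ∑ m ∈ Finset.Icc (l - N₃) (n + (N₁ + N₂)), A n p * B p m * C m l := fun p hp => by
    rw [Finset.mem_Icc] at hp
    rw [biMul_eq_sum hB hC (hi := n + (N₁ + N₂)) le_rfl (by omega), Finset.mul_sum]
    exact Finset.sum_congr rfl fun m _ => (mul_assoc _ _ _).symm
  rw [Finset.sum_congr rfl h1, Finset.sum_congr rfl h2, Finset.sum_comm]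

/-- The identity matrix. -/
def biOne : BiMatrix := fun n m => if n = m then 1 else 0

theorem isBand_biOne : IsBand 0 biOne := fun n m h => if_neg (by omega)

theorem biOne_biMul (A : BiMatrix) : biMul biOne A = A := by
  funext n l
  rw [biMul, finsum_eq_single _ n]
  · simp [biOne]
  · intro m hm
    simp [biOne, hm.symm]

theorem biMul_biOne (A : BiMatrix) : biMul A biOne = A := by
  funext n l
  rw [biMul, finsum_eq_single _ l]
  · simp [biOne]
  · intro m hm
    simp [biOne, hm]

/-- The additive group of matrices with finitely many nonzero diagonals above the main one. -/
def bandSubgroup : AddSubgroup BiMatrix where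
  carrier := {A | ∃ N, IsBand N A}
  add_mem' := by
    rintro A B ⟨N, hA⟩ ⟨N', hB⟩
    exact ⟨max N N', fun n m h => by
      change A n m + B n m = 0
      rw [hA n m (by omega), hB n m (by omega), add_zero]⟩
  zero_mem' := ⟨0, fun _ _ _ => rfl⟩
  neg_mem' := by
    rintro A ⟨N, hA⟩
    exact ⟨N, fun n m h => by change - A n m = 0; rw [hA n m h, neg_zero]⟩

/-- Matrices with finitely many nonzero diagonals above the main one. -/
abbrev BandMatrix : Type := bandSubgroup

instance : Mul BandMatrix :=
  ⟨fun A B => ⟨biMul A B, A.2.choose + B.2.choose, A.2.choose_spec.biMul B.2.choose_spec⟩⟩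

instance : One BandMatrix := ⟨⟨biOne, 0, isBand_biOne⟩⟩

theorem BandMatrix.coe_mul (A B : BandMatrix) : ((A * B : BandMatrix) : BiMatrix) = biMul A B := rfl

theorem BandMatrix.coe_one : ((1 : BandMatrix) : BiMatrix) = biOne := rfl

/-- The window may be enlarged freely, so entries of several products can be summed over one common
interval. -/
theorem BandMatrix.mul_apply (A B : BandMatrix) {n l : ℤ} : ∃ lo hi, ∀ lo' ≤ lo, ∀ hi' ≥ hi,
    biMul A B n l = ∑ m ∈ Finset.Icc lo' hi', (A : BiMatrix) n m * (B : BiMatrix) m l := by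
  obtain ⟨N, hA⟩ := A.2
  obtain ⟨N', hB⟩ := B.2
  exact ⟨l - N', n + N, fun lo' hlo hi' hhi => biMul_eq_sum hA hB hlo hhi⟩

instance : Ring BandMatrix where
  toAddCommGroup := inferInstance
  mul_assoc A B C := by
    obtain ⟨N₁, hA⟩ := A.2
    obtain ⟨N₂, hB⟩ := B.2
    obtain ⟨N₃, hC⟩ := C.2
    exact Subtype.ext (biMul_assoc hA hB hC)
  one_mul A := Subtype.ext (biOne_biMul A)
  mul_one A := Subtype.ext (biMul_biOne A)
  left_distrib A B C := by
    refine Subtype.ext (funext fun n => funext fun l => ?_)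
    change biMul A (B + C : BandMatrix) n l = biMul A B n l + biMul A C n l
    obtain ⟨lo₁, hi₁, h₁⟩ := A.mul_apply (B + C) (n := n) (l := l)
    obtain ⟨lo₂, hi₂, h₂⟩ := A.mul_apply B (n := n) (l := l)
    obtain ⟨lo₃, hi₃, h₃⟩ := A.mul_apply C (n := n) (l := l)
    rw [h₁ (min lo₁ (min lo₂ lo₃)) (by omega) (max hi₁ (max hi₂ hi₃)) (by omega),
      h₂ (min lo₁ (min lo₂ lo₃)) (by omega) (max hi₁ (max hi₂ hi₃)) (by omega),
      h₃ (min lo₁ (min lo₂ lo₃)) (by omega) (max hi₁ (max hi₂ hi₃)) (by omega),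
      ← Finset.sum_add_distrib]
    exact Finset.sum_congr rfl fun m _ => mul_add _ _ _
  right_distrib A B C := by
    refine Subtype.ext (funext fun n => funext fun l => ?_)
    change biMul (A + B : BandMatrix) C n l = biMul A C n l + biMul B C n l
    obtain ⟨lo₁, hi₁, h₁⟩ := (A + B).mul_apply C (n := n) (l := l)
    obtain ⟨lo₂, hi₂, h₂⟩ := A.mul_apply C (n := n) (l := l)
    obtain ⟨lo₃, hi₃, h₃⟩ := B.mul_apply C (n := n) (l := l)
    rw [h₁ (min lo₁ (min lo₂ lo₃)) (by omega) (max hi₁ (max hi₂ hi₃)) (by omega),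
      h₂ (min lo₁ (min lo₂ lo₃)) (by omega) (max hi₁ (max hi₂ hi₃)) (by omega),
      h₃ (min lo₁ (min lo₂ lo₃)) (by omega) (max hi₁ (max hi₂ hi₃)) (by omega),
      ← Finset.sum_add_distrib]
    exact Finset.sum_congr rfl fun m _ => add_mul _ _ _
  zero_mul A := Subtype.ext (funext fun n => funext fun l => by
    change ∑ᶠ m : ℤ, (0 : TimeField) * _ = 0
    simp)
  mul_zero A := Subtype.ext (funext fun n => funext fun l => by
    change ∑ᶠ m : ℤ, _ * (0 : TimeField) = 0
    simp)

theorem BandMatrix.coe_pow (A : BandMatrix) (k : ℕ) :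
    ((A ^ k : BandMatrix) : BiMatrix) = biPow A k := by
  induction k with
  | zero => rw [pow_zero]; rfl
  | succ k ih => rw [pow_succ', BandMatrix.coe_mul, ih]; rfl

/-- The entrywise derivative of a matrix. -/
def bandDeriv (k : ℕ+) : BandMatrix →+ BandMatrix where
  toFun A := ⟨fun n m => timeDeriv k ((A : BiMatrix) n m), A.2.choose, fun n m h => by
    change timeDeriv k ((A : BiMatrix) n m) = 0
    rw [A.2.choose_spec n m h, timeDeriv_zero]⟩
  map_zero' := Subtype.ext (funext fun n => funext fun m => timeDeriv_zero k)
  map_add' A B := Subtype.ext (funext fun n => funext fun m => timeDeriv_add k _ _)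

theorem bandDeriv_apply (k : ℕ+) (A : BandMatrix) (n m : ℤ) :
    (bandDeriv k A : BiMatrix) n m = timeDeriv k ((A : BiMatrix) n m) := rfl

theorem bandDeriv_mul (k : ℕ+) (A B : BandMatrix) :
    bandDeriv k (A * B) = bandDeriv k A * B + A * bandDeriv k B := by
  refine Subtype.ext (funext fun n => funext fun l => ?_)
  change timeDeriv k (biMul A B n l) = biMul (bandDeriv k A) B n l + biMul A (bandDeriv k B) n l
  obtain ⟨lo₁, hi₁, h₁⟩ := A.mul_apply B (n := n) (l := l)
  obtain ⟨lo₂, hi₂, h₂⟩ := (bandDeriv k A).mul_apply B (n := n) (l := l)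
  obtain ⟨lo₃, hi₃, h₃⟩ := A.mul_apply (bandDeriv k B) (n := n) (l := l)
  rw [h₁ (min lo₁ (min lo₂ lo₃)) (by omega) (max hi₁ (max hi₂ hi₃)) (by omega),
    h₂ (min lo₁ (min lo₂ lo₃)) (by omega) (max hi₁ (max hi₂ hi₃)) (by omega),
    h₃ (min lo₁ (min lo₂ lo₃)) (by omega) (max hi₁ (max hi₂ hi₃)) (by omega),
    ← Finset.sum_add_distrib, timeDeriv_sum]
  exact Finset.sum_congr rfl fun m _ => timeDeriv_mul k _ _

theorem bandDeriv_one (k : ℕ+) : bandDeriv k 1 = 0 := by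
  refine Subtype.ext (funext fun n => funext fun l => ?_)
  change timeDeriv k (if n = l then 1 else 0) = 0
  split_ifs
  · exact timeDeriv_one k
  · exact timeDeriv_zero k

/-- The shift matrix. -/
def bandShift : BandMatrix := ⟨shiftMatrix, 1, fun n m h => if_neg (by omega)⟩

theorem bandDeriv_shift (k : ℕ+) : bandDeriv k bandShift = 0 := by
  refine Subtype.ext (funext fun n => funext fun l => ?_)
  change timeDeriv k (if l = n + 1 then 1 else 0) = 0
  split_ifs
  · exact timeDeriv_one k
  · exact timeDeriv_zero k

theorem bandShift_pow_apply (k : ℕ) (n m : ℤ) :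
    (bandShift ^ k : BandMatrix).1 n m = if m = n + k then 1 else 0 := by
  induction k generalizing n m with
  | zero =>
    rw [pow_zero]
    change (if n = m then (1 : TimeField) else 0) = _
    congr 1
    simp [eq_comm]
  | succ k ih =>
    rw [pow_succ']
    change ∑ᶠ p : ℤ, (if p = n + 1 then (1 : TimeField) else 0) *
        (bandShift ^ k : BandMatrix).1 p m = _
    rw [finsum_eq_single _ (n + 1) (fun p hp => by rw [if_neg hp, zero_mul]), if_pos rfl, one_mul, ih]
    congr 1
    push_cast
    rw [add_assoc, add_comm 1]

theorem mul_bandShift_pow_apply (A : BandMatrix) (k : ℕ) (n m : ℤ) :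
    (A * bandShift ^ k : BandMatrix).1 n m = A.1 n (m - k) := by
  change ∑ᶠ p : ℤ, A.1 n p * (bandShift ^ k : BandMatrix).1 p m = _
  rw [finsum_eq_single _ (m - k), bandShift_pow_apply, if_pos (by omega), mul_one]
  intro p hp
  rw [bandShift_pow_apply, if_neg (by omega), mul_zero]

theorem sum_Icc_int (m : ℤ) (i : ℕ) (h : ℤ → TimeField) :
    ∑ p ∈ Finset.Icc m (m + i), h p = ∑ j ∈ Finset.range (i + 1), h (m + j) := by
  refine Finset.sum_nbij' (fun p => (p - m).toNat) (fun j => m + j) ?_ ?_ ?_ ?_ ?_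
  · intro p hp; rw [Finset.mem_Icc] at hp; rw [Finset.mem_range]; omega
  · intro j hj; rw [Finset.mem_range] at hj; rw [Finset.mem_Icc]; omega
  · intro p hp; rw [Finset.mem_Icc] at hp; omega
  · intro j _; omega
  · intro p hp; rw [Finset.mem_Icc] at hp; congr 1; omega

/-- The entries, from the diagonal downwards, of the `m`-th column of the inverse of a lower
unitriangular matrix. -/
def inverseColumn (S : BiMatrix) (m : ℤ) : ℕ → TimeField
  | i => if i = 0 then 1 else - ∑ j : Fin i, S (m + i) (m + (j : ℕ)) * inverseColumn S m j
decreasing_by exact j.2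

/-- Forward substitution down each column, starting from the diagonal entry `1`. -/
theorem exists_right_inverse (S : BandMatrix) (hS : IsBand 0 S.1) (hS1 : ∀ n, S.1 n n = 1) :
    ∃ T : BandMatrix, IsBand 0 T.1 ∧ (∀ n, T.1 n n = 1) ∧ S * T = 1 := by
  have hT : IsBand 0 (fun n m => if m ≤ n then inverseColumn S.1 m (n - m).toNat else 0) :=
    fun n m h => if_neg (by omega)
  refine ⟨⟨_, 0, hT⟩, hT, fun n => ?_, Subtype.ext (funext fun n => funext fun m => ?_)⟩
  · change (if n ≤ n then inverseColumn S.1 n (n - n).toNat else 0) = 1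
    rw [if_pos le_rfl, sub_self, inverseColumn]
    rfl
  · rw [BandMatrix.coe_mul, BandMatrix.coe_one, biMul_eq_sum hS hT (lo := m) (hi := n)
      (by omega) (by omega), biOne]
    by_cases h : m ≤ n
    · obtain ⟨i, rfl⟩ : ∃ i : ℕ, n = m + i := ⟨(n - m).toNat, by omega⟩
      rw [sum_Icc_int, Finset.sum_range_succ, hS1, one_mul, if_pos h,
        show (m + (i : ℤ) - m).toNat = i by omega]
      have h1 : ∀ j ∈ Finset.range i, S.1 (m + i) (m + j) * (if m ≤ m + (j : ℤ) then
          inverseColumn S.1 m (m + (j : ℤ) - m).toNat else 0) =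
          S.1 (m + i) (m + j) * inverseColumn S.1 m j := fun j _ => by
        rw [if_pos (by omega), show (m + (j : ℤ) - m).toNat = j by omega]
      rw [Finset.sum_congr rfl h1, Finset.sum_range, inverseColumn]
      by_cases hi : i = 0
      · subst hi; simp
      · rw [if_neg hi, add_neg_cancel, if_neg (by omega)]
    · rw [Finset.Icc_eq_empty h, Finset.sum_empty, if_neg (by omega)]

/-- The right inverse `T` is again lower unitriangular and has a right inverse of its own, which
must equal `S`. -/
theorem exists_inverse (S : BandMatrix) (hS : IsBand 0 S.1) (hS1 : ∀ n, S.1 n n = 1) :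
    ∃ T : BandMatrix, IsBand 0 T.1 ∧ (∀ n, T.1 n n = 1) ∧ S * T = 1 ∧ T * S = 1 := by
  obtain ⟨T, hT, hT1, h⟩ := exists_right_inverse S hS hS1
  obtain ⟨R, -, -, h'⟩ := exists_right_inverse T hT hT1
  refine ⟨T, hT, hT1, h, ?_⟩
  have : S = R := by rw [← mul_one S, ← h', ← mul_assoc, h, one_mul]
  rw [this, h']

end BandMatrices

/-! ### Dressing and the triangularity criteria. -/

/-- The Lax equation for a dressed shift. -/
theorem lax_of_dressing {R : Type*} [Ring R] (D : R →+ R)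
    (hD : ∀ x y, D (x * y) = D x * y + x * D y) (hD1 : D 1 = 0) {S T X Y : R} (hX : D X = 0)
    (hXY : X * Y = Y * X) (hST : S * T = 1) (hTS : T * S = 1) :
    D (S * X * T) = (D S + S * Y) * T * (S * X * T) - S * X * T * ((D S + S * Y) * T) := by
  have hDT : S * D T = - (D S * T) := by
    have := hD S T
    rw [hST, hD1] at this
    exact eq_neg_of_add_eq_zero_right this.symm
  have hDT' : D T = - (T * D S * T) := by
    rw [← one_mul (D T), ← hTS, mul_assoc, hDT, mul_neg, mul_assoc]
  have e1 : (D S + S * Y) * T * (S * X * T) = D S * X * T + S * (Y * X) * T := by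
    calc _ = (D S + S * Y) * (T * S) * X * T := by noncomm_ring
      _ = _ := by rw [hTS]; noncomm_ring
  have e2 : S * X * T * ((D S + S * Y) * T) = S * X * (T * D S * T) + S * (X * Y) * T := by
    calc _ = S * X * (T * D S * T) + S * X * (T * S) * Y * T := by noncomm_ring
      _ = _ := by rw [hTS]; noncomm_ring
  rw [e1, e2, hD, hD, hX, hDT', hXY]
  noncomm_ring

theorem dressed_pow {R : Type*} [Ring R] {S T : R} (X : R) (hST : S * T = 1) (hTS : T * S = 1)
    (k : ℕ) :
    (S * X * T) ^ k = S * X ^ k * T := by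
  induction k with
  | zero => simp [hST]
  | succ k ih =>
    rw [pow_succ, ih, pow_succ]
    calc S * X ^ k * T * (S * X * T) = S * X ^ k * (T * S) * X * T := by noncomm_ring
      _ = _ := by rw [hTS]; noncomm_ring

section Dressing

variable {S T : BandMatrix}

theorem upperPart_eq_add {A B : BiMatrix} (hA : IsBand (-1) A)
    (h : ∀ n m, m < n → (A + B) n m = 0) : upperPart B = A + B := by
  funext n m
  rw [upperPart]
  split_ifs with hnm
  · change B n m = A n m + B n m
    rw [hA n m (by omega), zero_add]
  · exact (h n m (by omega)).symm

theorem isBand_bandDeriv (hS : IsBand 0 S.1) (hS1 : ∀ n, S.1 n n = 1) (k : ℕ+) :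
    IsBand (-1) (bandDeriv k S).1 := fun n m h => by
  rw [bandDeriv_apply]
  rcases eq_or_lt_of_le (show n ≤ m by omega) with rfl | h'
  · rw [hS1, timeDeriv_one]
  · rw [hS n m (by omega), timeDeriv_zero]

/-- Sato's construction: a lower unitriangular `S` for which `(∂S/∂t_k + S Λ^k) S⁻¹` is upper
triangular for all `k` dresses the shift to a solution of the discrete KP hierarchy. -/
theorem isDiscreteKPSolution_of_dressing (hS : IsBand 0 S.1) (hS1 : ∀ n, S.1 n n = 1)
    (hT : IsBand 0 T.1) (hT1 : ∀ n, T.1 n n = 1) (hST : S * T = 1) (hTS : T * S = 1)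
    (hup : ∀ (k : ℕ+) (n m : ℤ), m < n →
      ((bandDeriv k S + S * bandShift ^ (k : ℕ)) * T : BandMatrix).1 n m = 0) :
    ∃ L : BiMatrix, IsDiscreteKPSolution L ∧ biMul L S.1 = biMul S.1 shiftMatrix ∧
      ∀ (k : ℕ+) (n m : ℤ),
        timeDeriv k (S.1 n m) + biMul S.1 (biPow shiftMatrix k) n m =
          biMul (upperPart (biPow L k)) S.1 n m := by
  have hSΛ : IsBand 1 (S * bandShift : BandMatrix).1 := fun n m h => by
    have := mul_bandShift_pow_apply S 1 n m
    rw [pow_one] at this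
    rw [this, hS _ _ (by push_cast; omega)]
  -- Here `(∂S + S Λ^k) T = ∂S T + L^k`, and `∂S T` is strictly lower triangular because `S` has
  -- constant diagonal. As the sum is upper triangular by `hup`, it is `(L^k)_+`.
  have hpos : ∀ k : ℕ+, upperPart (biPow (S * bandShift * T : BandMatrix).1 k) =
      ((bandDeriv k S + S * bandShift ^ (k : ℕ)) * T : BandMatrix).1 := fun k => by
    have h1 : (bandDeriv k S + S * bandShift ^ (k : ℕ)) * T =
        bandDeriv k S * T + (S * bandShift * T) ^ (k : ℕ) := by
      rw [dressed_pow _ hST hTS, add_mul]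
    rw [← BandMatrix.coe_pow]
    have h2 := hup k
    rw [h1] at h2 ⊢
    refine upperPart_eq_add (fun n m h => ?_) h2
    exact (isBand_bandDeriv hS hS1 k).biMul hT n m (by omega)
  refine ⟨(S * bandShift * T : BandMatrix).1, ⟨fun n => ?_, fun n m h => ?_, fun k n m => ?_⟩,
    ?_, fun k n m => ?_⟩
  · rw [BandMatrix.coe_mul, biMul_eq_sum hSΛ hT (lo := n + 1) (hi := n + 1) (by omega) le_rfl,
      Finset.Icc_self, Finset.sum_singleton, hT1, mul_one]
    have := mul_bandShift_pow_apply S 1 n (n + 1)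
    rw [pow_one] at this
    rw [this, Nat.cast_one, add_sub_cancel_right, hS1]
  · exact hSΛ.biMul hT n m (by omega)
  · rw [hpos]
    exact congrFun (congrFun (congrArg Subtype.val (lax_of_dressing (bandDeriv k) (bandDeriv_mul k)
      (bandDeriv_one k) (bandDeriv_shift k)
          (pow_succ' bandShift (k : ℕ) ▸ pow_succ bandShift (k : ℕ))
      hST hTS)) n) m
  · have h : S * bandShift * T * S = S * bandShift := by rw [mul_assoc, hTS, mul_one]
    exact congrArg Subtype.val h
  · rw [hpos]
    have h : (bandDeriv k S + S * bandShift ^ (k : ℕ)) * T * S =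
        bandDeriv k S + S * bandShift ^ (k : ℕ) := by rw [mul_assoc, hTS, mul_one]
    have h2 := congrFun (congrFun (congrArg Subtype.val h) n) m
    rw [BandMatrix.coe_mul] at h2
    rw [h2, ← show (bandShift : BandMatrix).1 = shiftMatrix from rfl, ← BandMatrix.coe_pow]
    rfl

theorem deriv_add_apply (k : ℕ+) (n l : ℤ) :
    (bandDeriv k S + S * bandShift ^ (k : ℕ) : BandMatrix).1 n l =
      timeDeriv k (S.1 n l) + S.1 n (l - (k : ℕ)) := by
  rw [← mul_bandShift_pow_apply]
  rfl

theorem isBand_deriv_add (hS : IsBand 0 S.1) (k : ℕ+) :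
    IsBand (k : ℕ) (bandDeriv k S + S * bandShift ^ (k : ℕ) : BandMatrix).1 := fun n m h => by
  have := k.pos
  rw [deriv_add_apply, hS n m (by omega), hS n (m - (k : ℕ)) (by omega), timeDeriv_zero, add_zero]

theorem inverse_block (hS : IsBand 0 S.1) (hS1 : ∀ n, S.1 n n = 1) (hT : IsBand 0 T.1)
    (hST : S * T = 1) (hblock : ∀ n m : ℤ, 0 ≤ n → m < 0 → S.1 n m = 0) (l : ℕ) (m : ℤ)
        (hm : m < 0) :
    T.1 l m = 0 := by
  induction l using Nat.strong_induction_on with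
  | _ l ih =>
    have h := congrFun (congrFun (congrArg Subtype.val hST) l) m
    rw [BandMatrix.coe_mul, BandMatrix.coe_one, biMul_eq_sum hS hT (lo := m) (hi := l)
      (by omega) (by omega), biOne, if_neg (by omega), Finset.sum_eq_single
          (l : ℤ), hS1, one_mul] at h
    · exact h
    · intro p hp hpl
      rw [Finset.mem_Icc] at hp
      by_cases h0 : p < 0
      · rw [hblock _ _ (by omega) h0, zero_mul]
      · have := ih p.toNat (by omega)
        rw [Int.toNat_of_nonneg (by omega)] at this
        rw [this, mul_zero]
    · intro hcon
      exact absurd (Finset.mem_Icc.2 ⟨by omega, le_rfl⟩) hcon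

/-- Write `P = ∂S + S Λ^k = A S` with `A = P T`. Row `n` of `P` still kills `F a` for `a < n`, which
reads `∑_p A_{n,p} (S F_a)_p = 0`. Since `(S F_a)_p` vanishes for `p > a` and not for `p = a`, this
triangular system gives `A_{n,a} = 0`; the zero block handles negative columns. -/
theorem dressing_upper_nonneg (hS : IsBand 0 S.1) (hS1 : ∀ n, S.1 n n = 1) (hT : IsBand 0 T.1)
    (hST : S * T = 1) (hTS : T * S = 1)
    (hblock : ∀ n m : ℤ, 0 ≤ n → m < 0 → S.1 n m = 0) (F : ℕ → ℤ → TimeField)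
    (hF : ∀ (k : ℕ+) (a : ℕ) (m : ℤ), 0 ≤ m → timeDeriv k (F a m) = F a (m + (k : ℕ)))
    (hpos : ∀ n a : ℕ, a < n → ∑ m ∈ Finset.Icc (0 : ℤ) n, S.1 n m * F a m = 0)
    (hdiag : ∀ n : ℕ, ∑ m ∈ Finset.Icc (0 : ℤ) n, S.1 n m * F n m ≠ 0) (k : ℕ+) (n : ℕ) (m : ℤ)
    (hm : m < n) : ((bandDeriv k S + S * bandShift ^ (k : ℕ)) * T : BandMatrix).1 n m = 0 := by
  have hk := k.pos
  set P : BandMatrix := bandDeriv k S + S * bandShift ^ (k : ℕ) with hP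
  have hPb : IsBand (k : ℕ) P.1 := isBand_deriv_add hS k
  have hAb : IsBand (k : ℕ) (P * T : BandMatrix).1 := fun n m h => hPb.biMul hT n m (by omega)
  have hPneg : ∀ l < 0, P.1 n l = 0 := fun l hl => by
    rw [hP, deriv_add_apply, hblock _ _ (by omega) hl, hblock _ _ (by omega) (by omega),
      timeDeriv_zero, add_zero]
  have hAneg : ∀ m < 0, (P * T : BandMatrix).1 n m = 0 := fun m hm => by
    rw [BandMatrix.coe_mul, biMul_eq_sum hPb hT (lo := m) (hi := n + (k : ℕ)) (by omega) le_rfl]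
    refine Finset.sum_eq_zero fun l _ => ?_
    by_cases hl : l < 0
    · rw [hPneg l hl, zero_mul]
    · have := inverse_block hS hS1 hT hST hblock l.toNat m hm
      rw [Int.toNat_of_nonneg (by omega)] at this
      rw [this, mul_zero]
  -- Differentiate the orthogonality relation: `∂F_m = F_{m+k}` becomes, after reindexing, the shift
  -- in `S Λ^k`. The terms with `l < k` vanish by the zero block.
  have hPF : ∀ a : ℕ, a < n → ∑ l ∈ Finset.Icc (0 : ℤ) (n + (k : ℕ)), P.1 n l * F a l = 0 := by
    intro a ha
    have h1 := congrArg (timeDeriv k) (hpos n a ha)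
    rw [timeDeriv_sum, timeDeriv_zero] at h1
    have h2 : ∀ l ∈ Finset.Icc (0 : ℤ) (n + (k : ℕ)), P.1 n l * F a l =
        timeDeriv k (S.1 n l) * F a l + S.1 n (l - (k : ℕ)) * F a l := fun l _ => by
      rw [hP, deriv_add_apply, add_mul]
    rw [Finset.sum_congr rfl h2, Finset.sum_add_distrib, ← h1]
    have h3 : ∀ l ∈ Finset.Icc (0 : ℤ) n, timeDeriv k (S.1 n l * F a l) =
        timeDeriv k (S.1 n l) * F a l + S.1 n l * F a (l + (k : ℕ)) := fun l hl => by
      rw [timeDeriv_mul, hF k a l (Finset.mem_Icc.1 hl).1]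
    rw [Finset.sum_congr rfl h3, Finset.sum_add_distrib]
    congr 1
    · refine (Finset.sum_subset (Finset.Icc_subset_Icc le_rfl (by omega)) fun l hl hl' => ?_).symm
      rw [Finset.mem_Icc] at hl hl'
      rw [hS n l (by omega), timeDeriv_zero, zero_mul]
    · have h4 : ∑ l ∈ Finset.Icc (k : ℤ) (n + (k : ℕ)), S.1 n (l - (k : ℕ)) * F a l =
          ∑ l ∈ Finset.Icc (0 : ℤ) n, S.1 n l * F a (l + (k : ℕ)) := by
        refine Finset.sum_nbij' (fun l => l - (k : ℕ)) (fun l => l + (k : ℕ)) ?_ ?_ ?_ ?_ ?_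
        · intro l hl; rw [Finset.mem_Icc] at *; omega
        · intro l hl; rw [Finset.mem_Icc] at *; omega
        · intro l _; omega
        · intro l _; omega
        · intro l _; rw [sub_add_cancel]
      rw [← h4]
      refine (Finset.sum_subset (Finset.Icc_subset_Icc (by omega) le_rfl) fun l hl hl' => ?_).symm
      rw [Finset.mem_Icc] at hl hl'
      rw [hblock _ _ (by omega) (by omega), zero_mul]
  have hPS : P * T * S = P := by rw [mul_assoc, hTS, mul_one]
  have hU : ∀ a : ℕ, a < n → ∑ p ∈ Finset.Icc (0 : ℤ) (n + (k : ℕ)), (P * T : BandMatrix).1 n p *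
      ∑ l ∈ Finset.Icc (0 : ℤ) p, S.1 p l * F a l = 0 := by
    intro a ha
    rw [← hPF a ha]
    have h1 : ∀ l ∈ Finset.Icc (0 : ℤ) (n + (k : ℕ)), P.1 n l * F a l =
        ∑ p ∈ Finset.Icc (0 : ℤ) (n + (k : ℕ)), (P * T : BandMatrix).1 n p * (S.1 p l * F a l) := by
      intro l hl
      rw [Finset.mem_Icc] at hl
      conv_lhs => rw [← hPS, BandMatrix.coe_mul, biMul_eq_sum hAb hS (lo := 0) (hi := n + (k : ℕ))
        (by omega) le_rfl, Finset.sum_mul]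
      exact Finset.sum_congr rfl fun p _ => mul_assoc _ _ _
    rw [Finset.sum_congr rfl h1, Finset.sum_comm]
    refine Finset.sum_congr rfl fun p hp => ?_
    rw [Finset.mem_Icc] at hp
    rw [Finset.mul_sum]
    refine Finset.sum_subset (Finset.Icc_subset_Icc le_rfl hp.2) fun l hl hl' => ?_
    rw [Finset.mem_Icc] at hl hl'
    rw [hS p l (by omega), zero_mul, mul_zero]
  have hmain : ∀ a : ℕ, a < n → (P * T : BandMatrix).1 n a = 0 := by
    intro a
    induction a using Nat.strong_induction_on with
    | _ a ih =>
      intro ha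
      have h1 := hU a ha
      rw [Finset.sum_eq_single (a : ℤ)] at h1
      · exact (mul_eq_zero.1 h1).resolve_right (hdiag a)
      · intro p hp hpa
        rw [Finset.mem_Icc] at hp
        obtain ⟨q, rfl⟩ : ∃ q : ℕ, p = q := ⟨p.toNat, by omega⟩
        rcases lt_or_ge q a with h | h
        · rw [ih q h (by omega), zero_mul]
        · rw [hpos q a (by omega), mul_zero]
      · intro hcon
        exact absurd (Finset.mem_Icc.2 ⟨by omega, by omega⟩) hcon
  by_cases h0 : m < 0
  · exact hAneg m h0
  · have := hmain m.toNat (by omega)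
    rwa [Int.toNat_of_nonneg (by omega)] at this

/-- Row `-1 - c` of `S` is `∑_a v_{c,a} G_a` in negative columns. In its image under `∂ + (· Λ^k)`
the terms from `∂G_a` and from the shift cancel, leaving `∑_a ∂v_{c,a} G_a`. Column `m < -1 - c` of
`T` is orthogonal to every `G_a` with `a ≤ c`. -/
theorem dressing_upper_neg (hS : IsBand 0 S.1) (hS1 : ∀ n, S.1 n n = 1) (hT : IsBand 0 T.1)
    (hST : S * T = 1) (hblock : ∀ n m : ℤ, 0 ≤ n → m < 0 → S.1 n m = 0) (G : ℕ → ℤ → TimeField)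
    (hG : ∀ (k : ℕ+) (a : ℕ) (m : ℤ), m < 0 → timeDeriv k (G a m) = - G a (m - (k : ℕ)))
    (v : ℕ → ℕ → TimeField) (hv : ∀ c, v c c ≠ 0)
    (hneg : ∀ (c : ℕ) (m : ℤ), m < 0 → S.1 (-1 - c) m = ∑ a ∈ Finset.range (c + 1), v c a * G a m)
    (k : ℕ+) (c : ℕ) (m : ℤ) (hm : m < -1 - c) :
    ((bandDeriv k S + S * bandShift ^ (k : ℕ)) * T : BandMatrix).1 (-1 - c) m = 0 := by
  have hk := k.pos
  set P : BandMatrix := bandDeriv k S + S * bandShift ^ (k : ℕ) with hP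
  have hPb : IsBand (k : ℕ) P.1 := isBand_deriv_add hS k
  -- The off-diagonal entry of `S T = 1` in row `-1 - a` is a relation among the pairings of `G_0,
  -- …, G_a` with the column; the earlier ones vanish and `v a a` is nonzero.
  have hY : ∀ a : ℕ, m < -1 - a → ∑ l ∈ Finset.Icc m (-1), G a l * T.1 l m = 0 := by
    intro a
    induction a using Nat.strong_induction_on with
    | _ a ih =>
      intro ha
      have h := congrFun (congrFun (congrArg Subtype.val hST) (-1 - a)) m
      rw [BandMatrix.coe_mul, BandMatrix.coe_one, biMul_eq_sum hS hT (lo := m) (hi := -1)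
        (by omega) (by omega), biOne, if_neg (by omega)] at h
      have h1 : ∀ l ∈ Finset.Icc m (-1), S.1 (-1 - a) l * T.1 l m =
          ∑ b ∈ Finset.range (a + 1), v a b * (G b l * T.1 l m) := fun l hl => by
        rw [hneg a l (by rw [Finset.mem_Icc] at hl; omega), Finset.sum_mul]
        exact Finset.sum_congr rfl fun b _ => mul_assoc _ _ _
      rw [Finset.sum_congr rfl h1, Finset.sum_comm] at h
      simp only [← Finset.mul_sum] at h
      rw [Finset.sum_range_succ, Finset.sum_eq_zero, zero_add] at h
      · exact (mul_eq_zero.1 h).resolve_left (hv a)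
      · intro b hb
        rw [Finset.mem_range] at hb
        rw [ih b hb (by omega), mul_zero]
  rw [BandMatrix.coe_mul, biMul_eq_sum hPb hT (lo := m) (hi := (k : ℕ)) (by omega) (by omega)]
  have h1 : ∑ l ∈ Finset.Icc m ((k : ℕ) : ℤ), P.1 (-1 - c) l * T.1 l m =
      ∑ l ∈ Finset.Icc m (-1), P.1 (-1 - c) l * T.1 l m := by
    refine (Finset.sum_subset (Finset.Icc_subset_Icc le_rfl (by omega)) fun l hl hl' => ?_).symm
    rw [Finset.mem_Icc] at hl hl'
    have := inverse_block hS hS1 hT hST hblock l.toNat m (by omega)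
    rw [Int.toNat_of_nonneg (by omega)] at this
    rw [this, mul_zero]
  have h2 : ∀ l ∈ Finset.Icc m (-1), P.1 (-1 - c) l * T.1 l m =
      ∑ a ∈ Finset.range (c + 1), timeDeriv k (v c a) * (G a l * T.1 l m) := fun l hl => by
    rw [Finset.mem_Icc] at hl
    rw [hP, deriv_add_apply, hneg c l (by omega), hneg c (l - (k : ℕ)) (by omega), timeDeriv_sum,
      ← Finset.sum_add_distrib, Finset.sum_mul]
    refine Finset.sum_congr rfl fun a _ => ?_
    rw [timeDeriv_mul, hG k a l (by omega)]
    ring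
  rw [h1, Finset.sum_congr rfl h2, Finset.sum_comm]
  refine Finset.sum_eq_zero fun a ha => ?_
  rw [Finset.mem_range] at ha
  rw [← Finset.mul_sum, hY a (by omega), mul_zero]

end Dressing

/-! ### Rows of the wave matrix of the Wronskian sequence. -/

instance : IsDomain TimeSeries := NoZeroDivisors.to_isDomain _

theorem negHom_injective : Function.Injective negHom := fun f g h => by
  have : ∀ f, negHom (negHom f) = f := fun f => by
    rw [negHom, MvPowerSeries.rescale_rescale]
    have h1 : ((fun _ => -1 : ℕ+ → ℂ) * fun _ => -1) = 1 := by funext; simp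
    rw [h1, MvPowerSeries.rescale_one]
    rfl
  rw [← this f, h, this]

theorem negHom_smul (r : ℂ) (f : TimeSeries) : negHom (r • f) = r • negHom f :=
  map_smul negLinear r f

theorem miwaCoeff_smul (r : ℂ) (f : TimeSeries) (i : ℕ) :
    miwaCoeff (r • f) i = r • miwaCoeff f i := by
  rw [← coeff_miwaHom, ← coeff_miwaHom, MvPowerSeries.smul_eq_C_mul, map_mul, miwaHom_C,
    PowerSeries.coeff_C_mul, MvPowerSeries.smul_eq_C_mul]

theorem waveMatrix_of_eq_smul (τ : ℤ → TimeSeries) (n : ℤ) (r : ℂ) (hr : r ≠ 0) (f : TimeSeries)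
    (h : τ n = r • f) (m : ℤ) (hm : m ≤ n) : waveMatrix τ n m =
      algebraMap TimeSeries TimeField (PowerSeries.coeff (n - m).toNat (miwaHom f)) /
        algebraMap TimeSeries TimeField f := by
  have hC : algebraMap TimeSeries TimeField (MvPowerSeries.C r) ≠ 0 :=
    algebraMap_timeField_ne_zero fun h0 => hr
        (by simpa using congrArg MvPowerSeries.constantCoeff h0)
  rw [waveMatrix, if_pos hm, h, miwaCoeff_smul, coeff_miwaHom, MvPowerSeries.smul_eq_C_mul,
    MvPowerSeries.smul_eq_C_mul, map_mul, map_mul, mul_div_mul_left _ _ hC]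

section Rows

variable (M : ℕ → ℂ)

/-- The functions `∑_j M_{j+a} h_{j-b}(t) / j!`. -/
def momentSeries (a b : ℕ) : TimeSeries := schurSeries (momentCoeff M a) b

theorem miwaHom_wronskianDet (d : ℕ) : miwaHom (wronskianDet M d) =
    (Matrix.of fun a q : Fin d => (PowerSeries.C (momentSeries M a (d - 1 - q)) -
        PowerSeries.X * PowerSeries.C (momentSeries M a (d - 1 - q + 1)) :
          PowerSeries TimeSeries)).det := by
  rw [wronskianDet, RingHom.map_det]
  congr 1
  ext1 a q
  exact miwaHom_schurSeries _ _

theorem miwaHom_negHom_wronskianDet (d : ℕ) : miwaHom (negHom (wronskianDet M d)) =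
    (Matrix.of fun a q : Fin d => miwaHom (negHom (momentSeries M a (d - 1 - q)))).det := by
  rw [wronskianDet, RingHom.map_det, RingHom.map_det]
  rfl

theorem coeff_zero_miwaHom_wronskianDet (d : ℕ) :
    PowerSeries.coeff 0 (miwaHom (wronskianDet M d)) = wronskianDet M d := by
  rw [PowerSeries.coeff_zero_eq_constantCoeff_apply, wronskianDet, RingHom.map_det, RingHom.map_det]
  congr 1
  ext1 a q
  change PowerSeries.constantCoeff (miwaHom (schurSeries _ _)) = schurSeries _ _
  rw [miwaHom_schurSeries]
  simp

theorem coeff_zero_miwaHom_negHom_wronskianDet (d : ℕ) :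
    PowerSeries.coeff 0 (miwaHom (negHom (wronskianDet M d))) = negHom (wronskianDet M d) := by
  rw [PowerSeries.coeff_zero_eq_constantCoeff_apply, wronskianDet, RingHom.map_det, RingHom.map_det,
    RingHom.map_det]
  congr 1
  ext1 a q
  change PowerSeries.constantCoeff (miwaHom (negHom (schurSeries _ _))) = negHom (schurSeries _ _)
  rw [miwaHom_negHom_schurSeries]
  simp

theorem sum_coeff_mul_momentSeries_eq_zero {d a : ℕ} (ha : a < d) :
    ∑ i ∈ Finset.range (d + 1), PowerSeries.coeff i (miwaHom (wronskianDet M d)) *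
      momentSeries M a (d - i) = 0 := by
  rw [miwaHom_wronskianDet]
  exact sum_coeff_det_C_sub_X_mul d (fun a => momentSeries M a) ⟨a, ha⟩

/-- Otherwise the coefficient vector, nonzero since its entry `0` is `wronskianDet M d`, would lie
in the kernel of the matrix of size `d + 1`. -/
theorem sum_coeff_mul_momentSeries_ne_zero (hM : ∀ d, wronskianDet M d ≠ 0) (d : ℕ) :
    ∑ i ∈ Finset.range (d + 1), PowerSeries.coeff i (miwaHom (wronskianDet M d)) *
      momentSeries M d (d - i) ≠ 0 := by
  intro h0
  refine hM (d + 1) (Matrix.exists_mulVec_eq_zero_iff.1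
    ⟨fun i => PowerSeries.coeff i (miwaHom (wronskianDet M d)), fun h => ?_, ?_⟩)
  · have := congrFun h 0
    rw [Fin.val_zero, coeff_zero_miwaHom_wronskianDet] at this
    exact hM d this
  · funext a
    have h1 : ∑ i ∈ Finset.range (d + 1), PowerSeries.coeff i (miwaHom (wronskianDet M d)) *
      momentSeries M a (d - i) = 0 := by
      rcases eq_or_lt_of_le (Nat.le_of_lt_succ a.2) with h | h
      · rw [h]; exact h0
      · exact sum_coeff_mul_momentSeries_eq_zero M h
    rw [Finset.sum_range] at h1
    rw [Pi.zero_apply, ← h1]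
    simp only [Matrix.mulVec, dotProduct]
    exact Finset.sum_congr rfl fun i _ => mul_comm (momentSeries M a (d - i)) _

theorem exists_coeff_miwaHom_negHom (hM : ∀ d, wronskianDet M d ≠ 0) (c : ℕ) :
    ∃ w : Fin (c + 1) → TimeSeries, w (Fin.last c) ≠ 0 ∧
      (∀ i, PowerSeries.coeff i (miwaHom (negHom (wronskianDet M (c + 1)))) =
        ∑ a : Fin (c + 1), negHom (momentSeries M a (c + i)) * w a) ∧
      ∀ b < c, ∑ a : Fin (c + 1), negHom (momentSeries M a b) * w a = 0 := by
  obtain ⟨w, hw, hw0⟩ := exists_coeff_det_of_eq_C_add_X_mul c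
    (fun a b => negHom (momentSeries M a b)) (fun a b => miwaHom (negHom (momentSeries M a b)))
    (fun a b => miwaHom_negHom_schurSeries _ _)
  have hdet : miwaHom (negHom (wronskianDet M (c + 1))) = (Matrix.of fun a q : Fin (c + 1) =>
    miwaHom (negHom (momentSeries M a (c - q)))).det := miwaHom_negHom_wronskianDet M (c + 1)
  rw [← hdet] at hw
  refine ⟨w, fun hlast => ?_, hw, hw0⟩
  -- If the last entry of `w` vanished, the other entries would solve a homogeneous system whose
  -- determinant is, up to sign change of `t`, the nonzero Wronskian of size `c`. Then `w = 0`,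
  -- against the nonvanishing of the coefficient of `u^0`.
  have hzero : (fun a : Fin c => w a.castSucc) = 0 := by
    by_contra hne
    refine hM c (negHom_injective ?_)
    rw [map_zero, wronskianDet, RingHom.map_det]
    refine Matrix.exists_vecMul_eq_zero_iff.1 ⟨_, hne, funext fun q => ?_⟩
    have hq := q.2
    have h1 := hw0 (c - 1 - q) (by omega)
    rw [Fin.sum_univ_castSucc, hlast, mul_zero, add_zero] at h1
    rw [Pi.zero_apply, ← h1]
    simp only [Matrix.vecMul, dotProduct]
    exact Finset.sum_congr rfl fun a _ => mul_comm (w a.castSucc) _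
  have h0 := hw 0
  rw [coeff_zero_miwaHom_negHom_wronskianDet, Finset.sum_eq_zero] at h0
  · exact hM (c + 1) (negHom_injective (by rw [h0, map_zero]))
  · intro a _
    refine mul_eq_zero_of_right _ ?_
    exact Fin.lastCases hlast (fun a => congrFun hzero a) a

end Rows

/-! ### Assembly of the two half-sequences. -/

/-- The sequence of determinants `wronskianDet` up to nonzero constants is a discrete KP `τ`
vector. -/
theorem isDiscreteKPTauVector_of_eq_smul (M : ℕ → ℂ) (hM : ∀ d, wronskianDet M d ≠ 0)
    (τ : ℤ → TimeSeries)
    (hpos : ∀ d : ℕ, ∃ r : ℂ, r ≠ 0 ∧ τ d = r • wronskianDet M d)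
    (hneg : ∀ c : ℕ, ∃ r : ℂ, r ≠ 0 ∧ τ (-1 - c) = r • negHom (wronskianDet M (c + 1))) :
    IsDiscreteKPTauVector τ := by
  have hnM : ∀ d, negHom (wronskianDet M d) ≠ 0 := fun d h =>
    hM d (negHom_injective (by rw [h, map_zero]))
  have hcases : ∀ n : ℤ, (∃ d : ℕ, n = d) ∨ ∃ c : ℕ, n = -1 - c := fun n => by
    rcases lt_or_ge n 0 with h | h
    · exact Or.inr ⟨(-1 - n).toNat, by omega⟩
    · exact Or.inl ⟨n.toNat, by omega⟩
  have hτ : ∀ n, τ n ≠ 0 := fun n => by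
    rcases hcases n with ⟨d, rfl⟩ | ⟨c, rfl⟩
    · obtain ⟨r, hr, h⟩ := hpos d
      rw [h]; exact smul_ne_zero hr (hM d)
    · obtain ⟨r, hr, h⟩ := hneg c
      rw [h]; exact smul_ne_zero hr (hnM _)
  have hwpos : ∀ (d : ℕ) (m : ℤ), m ≤ d → waveMatrix τ d m =
      algebraMap TimeSeries TimeField (PowerSeries.coeff (d - m).toNat
        (miwaHom (wronskianDet M d))) / algebraMap TimeSeries TimeField (wronskianDet M d) := by
    intro d m hm
    obtain ⟨r, hr, h⟩ := hpos d
    exact waveMatrix_of_eq_smul τ d r hr _ h m hm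
  have hwneg : ∀ (c : ℕ) (m : ℤ), m ≤ -1 - c → waveMatrix τ (-1 - c) m =
      algebraMap TimeSeries TimeField (PowerSeries.coeff (-1 - c - m).toNat
        (miwaHom (negHom (wronskianDet M (c + 1))))) /
        algebraMap TimeSeries TimeField (negHom (wronskianDet M (c + 1))) := by
    intro c m hm
    obtain ⟨r, hr, h⟩ := hneg c
    exact waveMatrix_of_eq_smul τ _ r hr _ h m hm
  have hband : IsBand 0 (waveMatrix τ) := fun n m h => if_neg (by omega)
  let S : BandMatrix := ⟨waveMatrix τ, 0, hband⟩
  have hS1 : ∀ n, S.1 n n = 1 := fun n => by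
    change waveMatrix τ n n = 1
    rcases hcases n with ⟨d, rfl⟩ | ⟨c, rfl⟩
    · rw [hwpos d d le_rfl, sub_self, Int.toNat_zero, coeff_zero_miwaHom_wronskianDet,
        div_self (algebraMap_timeField_ne_zero (hM d))]
    · rw [hwneg c _ le_rfl, sub_self, Int.toNat_zero, coeff_zero_miwaHom_negHom_wronskianDet,
        div_self (algebraMap_timeField_ne_zero (hnM _))]
  -- For `n ≥ 0` the shifted determinant has degree at most `n` in `u`, while column `m < 0` asks
  -- for the coefficient of `u^{n-m}`.
  have hblock : ∀ n m : ℤ, 0 ≤ n → m < 0 → S.1 n m = 0 := fun n m hn hm => by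
    obtain ⟨d, rfl⟩ : ∃ d : ℕ, n = d := ⟨n.toNat, by omega⟩
    change waveMatrix τ d m = 0
    rw [hwpos d m (by omega), miwaHom_wronskianDet, coeff_det_C_sub_X_mul_of_lt d
      (fun a => momentSeries M a) (by omega), map_zero, zero_div]
  have hsum : ∀ n a : ℕ, ∑ m ∈ Finset.Icc (0 : ℤ) n,
      S.1 n m * algebraMap TimeSeries TimeField (momentSeries M a m.toNat) =
      algebraMap TimeSeries TimeField (∑ i ∈ Finset.range (n + 1),
        PowerSeries.coeff i (miwaHom (wronskianDet M n)) * momentSeries M a (n - i)) /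
        algebraMap TimeSeries TimeField (wronskianDet M n) := by
    intro n a
    have h := sum_Icc_int 0 n fun m =>
      S.1 n m * algebraMap TimeSeries TimeField (momentSeries M a m.toNat)
    rw [zero_add] at h
    rw [h, ← Finset.sum_range_reflect, map_sum, Finset.sum_div]
    refine Finset.sum_congr rfl fun i hi => ?_
    rw [Finset.mem_range] at hi
    have h1 : waveMatrix τ n (0 + ((n + 1 - 1 - i : ℕ) : ℤ)) = _ := hwpos n _ (by omega)
    change waveMatrix τ n _ * _ = _
    rw [h1, map_mul, show ((n : ℤ) - (0 + ((n + 1 - 1 - i : ℕ) : ℤ))).toNat = i by omega,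
      show (0 + ((n + 1 - 1 - i : ℕ) : ℤ)).toNat = n - i by omega]
    ring
  obtain ⟨T, hT, hT1, hST, hTS⟩ := exists_inverse S hband hS1
  choose w hw using exists_coeff_miwaHom_negHom M hM
  refine ⟨hτ, isDiscreteKPSolution_of_dressing (S := S) hband hS1 hT hT1 hST hTS fun k n m hm => ?_⟩
  rcases hcases n with ⟨d, rfl⟩ | ⟨c, rfl⟩
  · refine dressing_upper_nonneg hband hS1 hT hST hTS hblock
      (fun a m => algebraMap TimeSeries TimeField (momentSeries M a m.toNat))
      (fun k a m h => ?_) (fun n a h => ?_) (fun n => ?_) k d m hm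
    · rw [timeDeriv_algebraMap, momentSeries, pderiv_schurSeries, momentSeries,
        show (m + (k : ℕ)).toNat = m.toNat + k by omega]
    · rw [hsum, sum_coeff_mul_momentSeries_eq_zero M h, map_zero, zero_div]
    · rw [hsum]
      exact div_ne_zero (algebraMap_timeField_ne_zero (sum_coeff_mul_momentSeries_ne_zero M hM n))
        (algebraMap_timeField_ne_zero (hM n))
  · refine dressing_upper_neg hband hS1 hT hST hblock
      (fun a m => algebraMap TimeSeries TimeField (negHom (momentSeries M a (-1 - m).toNat)))
      (fun k a m h => ?_)
      (fun c a => if h : a < c + 1 then algebraMap TimeSeries TimeField (w c ⟨a, h⟩) /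
        algebraMap TimeSeries TimeField (negHom (wronskianDet M (c + 1))) else 0)
      (fun c => ?_) (fun c m h => ?_) k c m hm
    · rw [timeDeriv_algebraMap, pderiv_negHom, map_neg, momentSeries, pderiv_schurSeries,
        momentSeries, show (-1 - (m - (k : ℕ))).toNat = (-1 - m).toNat + k by omega]
    · rw [dif_pos (Nat.lt_succ_self c)]
      exact div_ne_zero (algebraMap_timeField_ne_zero (hw c).1)
        (algebraMap_timeField_ne_zero (hnM _))
    · have h1 : ∑ a ∈ Finset.range (c + 1), (if h : a < c + 1 then
          algebraMap TimeSeries TimeField (w c ⟨a, h⟩) /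
          algebraMap TimeSeries TimeField (negHom (wronskianDet M (c + 1))) else 0) *
          algebraMap TimeSeries TimeField (negHom (momentSeries M a (-1 - m).toNat)) =
          algebraMap TimeSeries TimeField (∑ a : Fin (c + 1),
            negHom (momentSeries M a (-1 - m).toNat) * w c a) /
          algebraMap TimeSeries TimeField (negHom (wronskianDet M (c + 1))) := by
        rw [Finset.sum_range, map_sum, Finset.sum_div]
        refine Finset.sum_congr rfl fun a _ => ?_
        rw [dif_pos a.2, map_mul]
        ring
      rw [h1]
      change waveMatrix τ _ m = _
      -- The expansion must also hold above the diagonal, where `S` is zero; there the vanishing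
      -- pairings of `w` with `b < c` are used.
      by_cases hm' : m ≤ -1 - c
      · rw [hwneg c m hm', (hw c).2.1, show c + (-1 - (c : ℤ) - m).toNat = (-1 - m).toNat by omega]
      · rw [(hw c).2.2 (-1 - m).toNat (by omega), map_zero, zero_div]
        exact if_neg hm'

end DiscreteKP

end

theorem mainTheorem2 (W : ℝ → ℂ)
    (hW : ∀ a : ℝ, MeasureTheory.Integrable (fun x : ℝ => (Real.exp (a * x) : ℂ) * W x))
    (hW_support : ¬ (W =ᵐ[MeasureTheory.volume] 0))
    (C : ℕ → ℂ) (hC : ∀ d : ℕ, 1 ≤ d → C d ≠ 0) :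
    DiscreteKP.IsDiscreteKPTauVector
      (DiscreteKP.ZHatSequence C (DiscreteKP.moment W)) := by
  refine DiscreteKP.isDiscreteKPTauVector_of_eq_smul _
    (DiscreteKP.wronskianDet_ne_zero hW hW_support) _
    (fun d => DiscreteKP.exists_ZHat_eq C _ hC d) fun c => ?_
  obtain ⟨r, hr, h⟩ := DiscreteKP.exists_ZHat_eq C (DiscreteKP.moment W) hC (c + 1)
  refine ⟨r, hr, ?_⟩
  -- Position `-1 - c` carries `Ẑ_{c+1}(-t)`.
  have hc : (-1 - c : ℤ) = Int.negSucc c := by rw [Int.negSucc_eq]; ring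
  rw [hc, ← DiscreteKP.negHom_smul, ← h]
  rfl
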